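/- Let $\mathbb{N}=\{1,2,\dots\}$. For every $k\in\mathbb{N}$ let $\{Z_k(t)\}_{t\in\mathbb{N}}$ be a centered Gaussian process with unit variances and non-negative correlation function $A_k(s,t)=\mathbb{E}[Z_k(s)Z_k(t)]\ge 0$, and let $\{Z_\infty(t)\}_{t\in\mathbb{N}}$ be a stationary centered Gaussian process with unit variance and non-negative correlation function $A_\infty(\tau)=\mathbb{E}[Z_\infty(s)Z_\infty(s+\tau)]\ge 0$ (the processes may live on different probability spaces). Assume that, for every $\tau\in\{0,1,2,\dots\}$, $A_k(s,s+\tau)\to A_\infty(\tau)$ as $k\to\infty$, uniformly in $s\in\mathbb{N}$. Suppose further that, with $g_k(\tau):=\sup_{s\in\mathbb{N}}A_k(s,s+\tau)$, $$\lim_{L\to\infty}\limsup_{k\to\infty}\sum_{i=L}^\infty g_k(i)=0 .$$ Then for every $r\in\mathbb{R}$ the probabilities $\mathbb{P}(\sup_{1\le i\le n}Z_k(i)<r)$ and $\mathbb{P}(\sup_{1\le i\le n}Z_\infty(i)<r)$ are positive for all $k,n\in\mathbb{N}$, and $$\limsup_{k,n\to\infty}\frac1n\Big|\log\mathbb{P}\Big(\sup_{1\le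 i\le n}Z_k(i)<r\Big)-\log\mathbb{P}\Big(\sup_{1\le i\le n}Z_\infty(i)<r\Big)\Big|=0,$$ where $k$ and $n$ tend to infinity jointly, independently of each other. -/

import Mathlib

open MeasureTheory ProbabilityTheory Filter Topology
open scoped ENNReal

namespace Persistence

/-- The time `s + τ`, for a time `s ∈ {1, 2, …}` and a lag `τ ∈ {0, 1, 2, …}`. -/
def shift (s : ℕ+) (τ : ℕ) : ℕ+ := ⟨(s : ℕ) + τ, Nat.add_pos_left s.pos τ⟩

/-- `Z = (Z(t))_{t ∈ {1, 2, …}}` is, under `P`, a centered Gaussian process with nonnegative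
correlation function `A(s, t)`. As usual for a process specified through its correlation function,
the process has unit variance, so that `A` is also its covariance function. -/
structure IsCenteredGaussianWithCorr {Ω : Type*} [MeasurableSpace Ω]
    (P : Measure Ω) (Z : ℕ+ → Ω → ℝ) (A : ℕ+ → ℕ+ → ℝ) : Prop where
  gaussian : IsGaussianProcess Z P
  centered : ∀ t, ∫ ω, Z t ω ∂P = 0
  unit_variance : ∀ t, variance (Z t) P = 1
  corr : ∀ s t, covariance (Z s) (Z t) P = A s t
  nonneg : ∀ s t, 0 ≤ A s t

/-- `Z = (Z(t))_{t ∈ {1, 2, …}}` is, under `P`, a stationary centered Gaussian process with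
nonnegative correlation function `A(τ)`: the correlation of `Z(s)` and `Z(t)` is `A(|s - t|)`.
A centered Gaussian process is (strictly) stationary if and only if its covariances are invariant
under time shifts. -/
def IsStationaryCenteredGaussianWithCorr {Ω : Type*} [MeasurableSpace Ω]
    (P : Measure Ω) (Z : ℕ+ → Ω → ℝ) (A : ℕ → ℝ) : Prop :=
  IsCenteredGaussianWithCorr P Z (fun s t => A (Nat.dist (s : ℕ) (t : ℕ)))

/-- The supremum over all `s` of the correlations `A(s, s + τ)` at lag `τ` (as an extended
nonnegative number, so that it can be summed over `τ` without convergence conventions). -/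
noncomputable def supCorr (A : ℕ+ → ℕ+ → ℝ) (τ : ℕ) : ℝ≥0∞ :=
  ⨆ s : ℕ+, ENNReal.ofReal (A s (shift s τ))

/-- The persistence probability `P(sup_{1 ≤ i ≤ n} Z(i) < r)`. -/
noncomputable def persistenceProb {Ω : Type*} [MeasurableSpace Ω]
    (P : Measure Ω) (Z : ℕ+ → Ω → ℝ) (r : ℝ) (n : ℕ) : ℝ :=
  P.real {ω | ∀ i : ℕ+, (i : ℕ) ≤ n → Z i ω < r}

end Persistence

/-!
Nonnegative correlations and Slepian's inequality make `-log P(sup_{i ≤ n} Z_∞(i) < r)` subadditive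
in `n`, so by Fekete's lemma it is `θ n + o(n)`, and `-log P(sup_{i ≤ n} Z_k(i) < r)` is shown to be
`θ n + o(n)` jointly in `k` and `n`. By Slepian's inequality again, the probability for `Z_k` is at
least a product of probabilities of blocks of fixed length, each of which is close to that of `Z_∞`.

For the converse bound, restrict `Z_k` to blocks separated by long gaps. The matrix `E` of the
correlations across blocks has small row sums, so for some small `v` an independent Gaussian vector
with covariance `v • 1 - E` exists; adding it makes the blocks independent, and restoring unit
variances by Slepian's inequality costs only a small increase of the level `r`. Such an increase
hardly changes `θ`: since the correlations of `Z_∞` are summable, the Cameron–Martin shift that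
raises all coordinates of a window of length `M` by at least `η` has energy at most `B η² M`.
-/

namespace Persistence

open Matrix WithLp

section Orthant

variable {ι : Type*}

lemma measurableSet_forall_lt [Countable ι] {α : Type*} [MeasurableSpace α] {f : ι → α → ℝ}
    (hf : ∀ i, Measurable (f i)) (a : ι → ℝ) : MeasurableSet {x | ∀ i, f i x < a i} := by
  simp only [Set.ofPred_forall]
  exact .iInter fun i => measurableSet_lt (hf i) measurable_const

lemma posSemidef_smul_vecMulVec [Finite ι] (v : ι → ℝ) {h : ℝ} (hh : 0 ≤ h) :
    (h • vecMulVec v v).PosSemidef :=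
  PosSemidef.smul (by simpa using posSemidef_vecMulVec_self_star v) hh

lemma posSemidef_of_covariance_eq [Finite ι] {Ω : Type*} [MeasurableSpace Ω] {P : Measure Ω}
    [IsFiniteMeasure P] {X : ι → Ω → ℝ} (hX : ∀ i, MemLp (X i) 2 P) {S : Matrix ι ι ℝ}
    (hS : ∀ i j, cov[X i, X j; P] = S i j) : S.PosSemidef := by
  have := Fintype.ofFinite ι
  refine .of_dotProduct_mulVec_nonneg (by ext i j; simp [← hS, covariance_comm]) fun t => ?_
  have hnonneg := covarianceBilin_self_nonneg (μ := P.map fun ω => toLp 2 (X · ω)) (toLp 2 t)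
  rw [covarianceBilin_apply_pi hX] at hnonneg
  simpa [hS, dotProduct, mulVec, Finset.mul_sum, mul_assoc, mul_comm, mul_left_comm] using hnonneg

variable [Fintype ι] [DecidableEq ι]

/-- The probability that a centered Gaussian vector with covariance matrix `S` lies in the open
orthant below `a`. Persistence probabilities are of this form, and all comparison arguments are
carried out for them. If `S` is not positive semidefinite, this refers to the Dirac mass at `0`. -/
noncomputable def orthantProb (S : Matrix ι ι ℝ) (a : ι → ℝ) : ℝ :=
  (multivariateGaussian 0 S).real {x | ∀ i, x i < a i}

lemma orthantProb_nonneg (S : Matrix ι ι ℝ) (a : ι → ℝ) : 0 ≤ orthantProb S a :=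
  measureReal_nonneg

lemma orthantProb_mono (S : Matrix ι ι ℝ) : Monotone (orthantProb S) :=
  fun _ _ hab => measureReal_mono fun _ hx i => (hx i).trans_le (hab i)

lemma ofReal_orthantProb (S : Matrix ι ι ℝ) (a : ι → ℝ) :
    ENNReal.ofReal (orthantProb S a) = multivariateGaussian 0 S {x | ∀ i, x i < a i} := by
  simp [orthantProb]

lemma multivariateGaussian_conv_multivariateGaussian {S T : Matrix ι ι ℝ} (hS : S.PosSemidef)
    (hT : T.PosSemidef) (m m' : EuclideanSpace ℝ ι) :
    multivariateGaussian m S ∗ multivariateGaussian m' T =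
      multivariateGaussian (m + m') (S + T) := by
  refine Measure.ext_of_charFun (funext fun x => ?_)
  rw [charFun_conv, charFun_multivariateGaussian hS, charFun_multivariateGaussian hT,
    charFun_multivariateGaussian (hS.add hT), ← Complex.exp_add, add_mulVec, dotProduct_add,
    inner_add_right]
  push_cast
  ring_nf

lemma orthantProb_add_eq_prod {S T : Matrix ι ι ℝ} (hS : S.PosSemidef) (hT : T.PosSemidef)
    (a : ι → ℝ) :
    orthantProb (S + T) a = ((multivariateGaussian 0 S).prod (multivariateGaussian 0 T)).real
      {p | ∀ i, p.1 i + p.2 i < a i} := by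
  have hconv := multivariateGaussian_conv_multivariateGaussian hS hT 0 0
  rw [add_zero] at hconv
  rw [orthantProb, ← hconv, Measure.conv,
    map_measureReal_apply (by fun_prop) (measurableSet_forall_lt (fun i => by fun_prop) a)]
  rfl

lemma ofReal_orthantProb_add {S T : Matrix ι ι ℝ} (hS : S.PosSemidef) (hT : T.PosSemidef)
    (a : ι → ℝ) :
    ENNReal.ofReal (orthantProb (S + T) a) =
      ∫⁻ y, ENNReal.ofReal (orthantProb T (a - ofLp y)) ∂(multivariateGaussian 0 S) := by
  rw [orthantProb_add_eq_prod hS hT, ofReal_measureReal, Measure.prod_apply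
    (measurableSet_forall_lt (fun i => by fun_prop) a)]
  simp only [ofReal_orthantProb, Set.preimage_ofPred_eq, Pi.sub_apply, lt_sub_iff_add_lt']

lemma orthantProb_mul_le_orthantProb_add {S T : Matrix ι ι ℝ} (hS : S.PosSemidef)
    (hT : T.PosSemidef) (a b : ι → ℝ) :
    orthantProb S a * orthantProb T b ≤ orthantProb (S + T) (a + b) := by
  rw [orthantProb_add_eq_prod hS hT, orthantProb, orthantProb, ← measureReal_prod_prod]
  exact measureReal_mono fun p hp i => add_lt_add (hp.1 i) (hp.2 i)

lemma multivariateGaussian_map_smul {S : Matrix ι ι ℝ} (hS : S.PosSemidef) (c : ℝ)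
    (m : EuclideanSpace ℝ ι) :
    (multivariateGaussian m S).map (c • ·) = multivariateGaussian (c • m) (c ^ 2 • S) := by
  refine Measure.ext_of_charFun (funext fun x => ?_)
  rw [charFun_map_smul, charFun_multivariateGaussian hS,
    charFun_multivariateGaussian (hS.smul (sq_nonneg c))]
  simp only [ofLp_smul, mulVec_smul, smul_mulVec, dotProduct_smul, smul_dotProduct, inner_smul_left,
    inner_smul_right, smul_eq_mul, RCLike.conj_to_real]
  ring_nf

lemma orthantProb_sq_smul {S : Matrix ι ι ℝ} (hS : S.PosSemidef) {c : ℝ} (hc : 0 < c)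
    (a : ι → ℝ) : orthantProb (c ^ 2 • S) (c • a) = orthantProb S a := by
  have hmap := multivariateGaussian_map_smul hS c 0
  rw [smul_zero] at hmap
  rw [orthantProb, ← hmap, map_measureReal_apply (by fun_prop)
    (measurableSet_forall_lt (fun i => by fun_prop) _), orthantProb]
  simp [hc]

lemma gaussianReal_map_smul_eq_multivariateGaussian (v : ι → ℝ) (h : NNReal) :
    (gaussianReal 0 h).map (fun t => t • toLp 2 v) =
      multivariateGaussian 0 ((h : ℝ) • vecMulVec v v) := by
  refine Measure.ext_of_charFun (funext fun x => ?_)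
  have hcomm (t : ℝ) : inner ℝ (t • toLp 2 v) x = inner ℝ (toLp 2 v) x * t := by
    rw [real_inner_smul_left, mul_comm]
  have hinner : inner ℝ (toLp 2 v) x = ofLp x ⬝ᵥ v := by simp [PiLp.inner_apply, dotProduct]
  rw [charFun_multivariateGaussian (posSemidef_smul_vecMulVec v h.coe_nonneg), charFun_apply,
    integral_map (by fun_prop) (by fun_prop)]
  simp only [hcomm, Complex.ofReal_mul]
  rw [← charFun_apply_real, charFun_gaussianReal, hinner, smul_mulVec, vecMulVec_mulVec]
  simp [dotProduct_comm v, sq]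

lemma orthantProb_add_smul_vecMulVec {R : Matrix ι ι ℝ} (hR : R.PosSemidef) (h : NNReal)
    (v a : ι → ℝ) :
    orthantProb (R + (h : ℝ) • vecMulVec v v) a =
      ((multivariateGaussian 0 R).prod (gaussianReal 0 h)).real
        {p | ∀ i, p.1 i + p.2 * v i < a i} := by
  rw [orthantProb_add_eq_prod hR (posSemidef_smul_vecMulVec v h.coe_nonneg),
    ← gaussianReal_map_smul_eq_multivariateGaussian]
  nth_rw 1 [← Measure.map_id (μ := multivariateGaussian 0 R)]
  rw [Measure.map_prod_map _ _ (by fun_prop) (by fun_prop),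
    map_measureReal_apply (by fun_prop)
      (measurableSet_forall_lt (fun i => by fun_prop) a)]
  simp

lemma map_toLp_eq_multivariateGaussian {Ω : Type*} [MeasurableSpace Ω] {P : Measure Ω}
    {X : ι → Ω → ℝ} (hX : HasGaussianLaw (fun ω i => X i ω) P) (hmean : ∀ i, P[X i] = 0)
    {S : Matrix ι ι ℝ} (hS : ∀ i j, cov[X i, X j; P] = S i j) :
    P.map (fun ω => toLp 2 (X · ω)) = multivariateGaussian 0 S := by
  have := hX.isProbabilityMeasure
  have hL2 (i : ι) : MemLp (X i) 2 P := (hX.eval i).memLp_two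
  have := (hX.toLp_pi 2).isGaussian_map
  refine IsGaussian.ext ?_ ?_
  · have hint := (hX.toLp_pi 2).integrable
    rw [integral_id_multivariateGaussian', integral_map hint.aemeasurable (by fun_prop)]
    ext i
    simpa [hmean] using ((EuclideanSpace.proj i : EuclideanSpace ℝ ι →L[ℝ] ℝ).integral_comp_comm
      hint).symm
  · ext x y
    rw [covarianceBilin_apply_pi hL2,
      covarianceBilin_multivariateGaussian (posSemidef_of_covariance_eq hL2 hS)]
    simp [hS, dotProduct, mulVec, Finset.mul_sum, mul_comm, mul_left_comm]

lemma measureReal_forall_lt_eq_orthantProb {Ω : Type*} [MeasurableSpace Ω] {P : Measure Ω}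
    {X : ι → Ω → ℝ} (hX : HasGaussianLaw (fun ω i => X i ω) P) (hmean : ∀ i, P[X i] = 0)
    {S : Matrix ι ι ℝ} (hS : ∀ i j, cov[X i, X j; P] = S i j) (a : ι → ℝ) :
    P.real {ω | ∀ i, X i ω < a i} = orthantProb S a := by
  have := hX.isProbabilityMeasure
  rw [orthantProb, ← map_toLp_eq_multivariateGaussian hX hmean hS,
    map_measureReal_apply_of_aemeasurable (hX.toLp_pi 2).aemeasurable
      (measurableSet_forall_lt (fun i => by fun_prop) a)]
  rfl

lemma hasGaussianLaw_eval_multivariateGaussian (m : EuclideanSpace ℝ ι) (S : Matrix ι ι ℝ) :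
    HasGaussianLaw (fun (x : EuclideanSpace ℝ ι) i => x i) (multivariateGaussian m S) :=
  (IsGaussian.hasGaussianLaw_id (μ := multivariateGaussian m S)).map_equiv
    (PiLp.continuousLinearEquiv 2 ℝ fun _ => ℝ)

lemma integral_eval_multivariateGaussian (m : EuclideanSpace ℝ ι) (S : Matrix ι ι ℝ) (i : ι) :
    ∫ x, x i ∂(multivariateGaussian m S) = m i := by
  simpa using (EuclideanSpace.proj i : EuclideanSpace ℝ ι →L[ℝ] ℝ).integral_comp_id_comm
    (IsGaussian.integrable_id (μ := multivariateGaussian m S))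

end Orthant

section Independence

variable {ι : Type*} [Fintype ι] [DecidableEq ι]

lemma orthantProb_diagonal {d : ι → ℝ} (hd : ∀ i, 0 ≤ d i) (a : ι → ℝ) :
    orthantProb (diagonal d) a = ∏ i, (gaussianReal 0 (d i).toNNReal).real (Set.Iio (a i)) := by
  have hps : (diagonal d).PosSemidef := .diagonal hd
  have hindep : iIndepFun (fun i (x : EuclideanSpace ℝ ι) => x i)
      (multivariateGaussian 0 (diagonal d)) :=
    (hasGaussianLaw_eval_multivariateGaussian 0 _).iIndepFun_of_covariance_eq_zero
      fun i j hij => by rw [covariance_eval_multivariateGaussian hps, diagonal_apply_ne _ hij]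
  have hset : {x : EuclideanSpace ℝ ι | ∀ i, x i < a i} =
      ⋂ i, (fun x : EuclideanSpace ℝ ι => x i) ⁻¹' Set.Iio (a i) := by ext; simp
  rw [orthantProb, hset, measureReal_def,
    hindep.meas_iInter fun i => ⟨_, measurableSet_Iio, rfl⟩, ENNReal.toReal_prod]
  refine Finset.prod_congr rfl fun i _ => ?_
  have heval := measurePreserving_eval_multivariateGaussian (μ := 0) hps (i := i)
  rw [heval.measure_preimage measurableSet_Iio.nullMeasurableSet]
  simp [measureReal_def]

variable {κ : Type*} [DecidableEq κ] {β : κ → Type*}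

open scoped MatrixOrder in
lemma posSemidef_blockDiagonal' [Finite κ] [∀ k, Finite (β k)] {B : ∀ k, Matrix (β k) (β k) ℝ}
    (hB : ∀ k, (B k).PosSemidef) : (blockDiagonal' B).PosSemidef := by
  classical
  have := Fintype.ofFinite κ
  have := fun k => Fintype.ofFinite (β k)
  choose C hC using fun k => CStarAlgebra.nonneg_iff_eq_star_mul_self.1 (hB k).nonneg
  have hfactor : blockDiagonal' B = (blockDiagonal' C)ᴴ * blockDiagonal' C := by
    rw [blockDiagonal'_conjTranspose, ← blockDiagonal'_mul]
    exact congrArg _ (funext hC)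
  rw [hfactor]
  exact posSemidef_conjTranspose_mul_self _

variable [Fintype κ] [∀ k, Fintype (β k)] [∀ k, DecidableEq (β k)]

lemma orthantProb_blockDiagonal' {B : ∀ k, Matrix (β k) (β k) ℝ} (hB : ∀ k, (B k).PosSemidef)
    (a : (Σ k, β k) → ℝ) :
    orthantProb (blockDiagonal' B) a = ∏ k, orthantProb (B k) (fun i => a ⟨k, i⟩) := by
  have hps := posSemidef_blockDiagonal' hB
  have hlaw := hasGaussianLaw_eval_multivariateGaussian 0 (blockDiagonal' B)
  have hindep : iIndepFun (fun k (x : EuclideanSpace ℝ (Σ k, β k)) (i : β k) => x ⟨k, i⟩)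
      (multivariateGaussian 0 (blockDiagonal' B)) := by
    refine HasGaussianLaw.iIndepFun_of_covariance_eval ?_ fun k l hkl i j => ?_
    · exact hlaw.map (ContinuousLinearMap.pi fun k => ContinuousLinearMap.pi fun i =>
        ContinuousLinearMap.proj (R := ℝ) (φ := fun _ : Σ k, β k => ℝ) ⟨k, i⟩)
    · rw [covariance_eval_multivariateGaussian hps, blockDiagonal'_apply_ne _ _ _ hkl]
  have hset : {x : EuclideanSpace ℝ (Σ k, β k) | ∀ p, x p < a p} =
      ⋂ k, (fun (x : EuclideanSpace ℝ (Σ k, β k)) (i : β k) => x ⟨k, i⟩) ⁻¹'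
        {y | ∀ i, y i < a ⟨k, i⟩} := by ext; simp [Sigma.forall]
  rw [orthantProb, hset, measureReal_def, hindep.meas_iInter fun k =>
    ⟨_, measurableSet_forall_lt (fun i => by fun_prop) _, rfl⟩, ENNReal.toReal_prod]
  refine Finset.prod_congr rfl fun k _ => ?_
  refine measureReal_forall_lt_eq_orthantProb
    (X := fun i (x : EuclideanSpace ℝ (Σ k, β k)) => x ⟨k, i⟩) ?_ ?_ ?_ _
  · exact hlaw.map (ContinuousLinearMap.pi fun i : β k =>
      ContinuousLinearMap.proj (R := ℝ) (φ := fun _ : Σ k, β k => ℝ) ⟨k, i⟩)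
  · exact fun i => integral_eval_multivariateGaussian 0 _ _
  · intro i j
    rw [covariance_eval_multivariateGaussian hps, blockDiagonal'_apply_eq]

end Independence

section Continuity

variable {ι : Type*}

lemma frontier_forall_lt_subset [Finite ι] (a : ι → ℝ) :
    frontier {x : EuclideanSpace ℝ ι | ∀ i, x i < a i} ⊆ ⋃ i, {x | x i = a i} := by
  have hopen : IsOpen {x : EuclideanSpace ℝ ι | ∀ i, x i < a i} := by
    simp only [Set.ofPred_forall]
    exact isOpen_iInter_of_finite fun i => isOpen_lt (by fun_prop) continuous_const
  have hclosed : IsClosed {x : EuclideanSpace ℝ ι | ∀ i, x i ≤ a i} := by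
    simp only [Set.ofPred_forall]
    exact isClosed_iInter fun i => isClosed_le (by fun_prop) continuous_const
  rw [hopen.frontier_eq]
  rintro x ⟨hx, hx'⟩
  have hle : ∀ i, x i ≤ a i := closure_minimal (fun y hy i => (hy i).le) hclosed hx
  simp only [Set.mem_ofPred_eq, not_forall, not_lt] at hx'
  obtain ⟨i, hi⟩ := hx'
  exact Set.mem_iUnion.2 ⟨i, le_antisymm (hle i) hi⟩

variable [Fintype ι] [DecidableEq ι]

lemma multivariateGaussian_frontier_forall_lt {S : Matrix ι ι ℝ} (hS : S.PosSemidef)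
    (hpos : ∀ i, 0 < S i i) (m : EuclideanSpace ℝ ι) (a : ι → ℝ) :
    multivariateGaussian m S (frontier {x | ∀ i, x i < a i}) = 0 := by
  refine measure_mono_null (frontier_forall_lt_subset a) (measure_iUnion_null fun i => ?_)
  have := nullSingletonClass_gaussianReal (μ := m i) (Real.toNNReal_pos.2 (hpos i)).ne'
  have hpre := (measurePreserving_eval_multivariateGaussian (μ := m) hS (i := i)).measure_preimage
    (measurableSet_singleton (a i)).nullMeasurableSet
  rwa [measure_singleton] at hpre

lemma continuousWithinAt_orthantProb {S : Matrix ι ι ℝ} (hS : S.PosSemidef)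
    (hpos : ∀ i, 0 < S i i) (a : ι → ℝ) :
    ContinuousWithinAt (orthantProb · a) {T | T.PosSemidef} S := by
  have : FirstCountableTopology (Matrix ι ι ℝ) :=
    inferInstanceAs (FirstCountableTopology (ι → ι → ℝ))
  refine tendsto_of_seq_tendsto fun T hT => ?_
  obtain ⟨hlim, hps⟩ := tendsto_nhdsWithin_iff.1 hT
  let law (R : Matrix ι ι ℝ) : ProbabilityMeasure (EuclideanSpace ℝ ι) :=
    ⟨multivariateGaussian 0 R, inferInstance⟩
  have hlaw : Tendsto (law ∘ T) atTop (𝓝 (law S)) := by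
    refine ProbabilityMeasure.tendsto_of_tendsto_charFun fun t => ?_
    have hcont : Continuous fun R : Matrix ι ι ℝ =>
        Complex.exp (inner ℝ t 0 * Complex.I - (ofLp t ⬝ᵥ R *ᵥ ofLp t : ℝ) / 2) := by fun_prop
    have hcomp := (hcont.tendsto S).comp hlim
    rw [← charFun_multivariateGaussian hS] at hcomp
    refine hcomp.congr' (hps.mono fun n hn => ?_)
    exact (charFun_multivariateGaussian hn t).symm
  exact (ENNReal.continuousAt_toReal (measure_ne_top _ _)).tendsto.comp
    (ProbabilityMeasure.tendsto_measure_of_null_frontier_of_tendsto' hlaw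
      (multivariateGaussian_frontier_forall_lt hS hpos 0 a))

end Continuity

section Slepian

variable {ι : Type*} [Fintype ι] [DecidableEq ι]

/-- The lower orthant order between centered Gaussian vectors, in terms of their covariance
matrices. -/
def LowerOrthantLE (S T : Matrix ι ι ℝ) : Prop := ∀ a, orthantProb S a ≤ orthantProb T a

namespace LowerOrthantLE

lemma add {S S' T T' : Matrix ι ι ℝ} (hS : S.PosSemidef) (hS' : S'.PosSemidef)
    (hT : T.PosSemidef) (hT' : T'.PosSemidef) (h : LowerOrthantLE S S')
    (h' : LowerOrthantLE T T') : LowerOrthantLE (S + T) (S' + T') := by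
  have add_left {R T T' : Matrix ι ι ℝ} (hR : R.PosSemidef) (hT : T.PosSemidef)
      (hT' : T'.PosSemidef) (h : LowerOrthantLE T T') : LowerOrthantLE (R + T) (R + T') := by
    intro a
    rw [← ENNReal.ofReal_le_ofReal_iff (orthantProb_nonneg _ _), ofReal_orthantProb_add hR hT,
      ofReal_orthantProb_add hR hT']
    exact lintegral_mono fun y => ENNReal.ofReal_le_ofReal (h _)
  intro a
  refine (add_left hS hT hT' h' a).trans ?_
  rw [add_comm S, add_comm S']
  exact add_left hT' hS hS' h a

lemma sum {κ : Type*} (s : Finset κ) {S T : κ → Matrix ι ι ℝ} (hS : ∀ k, (S k).PosSemidef)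
    (hT : ∀ k, (T k).PosSemidef) (h : ∀ k, LowerOrthantLE (S k) (T k)) :
    LowerOrthantLE (∑ k ∈ s, S k) (∑ k ∈ s, T k) := by
  classical
  induction s using Finset.induction_on with
  | empty => exact fun a => le_rfl
  | insert k s hk ih =>
    rw [Finset.sum_insert hk, Finset.sum_insert hk]
    exact add (hS k) (hT k) (posSemidef_sum s fun k _ => hS k) (posSemidef_sum s fun k _ => hT k)
      (h k) ih

end LowerOrthantLE

omit [DecidableEq ι] in
lemma prod_measureReal_le_measureReal_iInter {μ : Measure ℝ} [IsProbabilityMeasure μ]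
    {s : ι → Set ℝ} (hs : ∀ i, IsLowerSet (s i)) : ∏ i, μ.real (s i) ≤ μ.real (⋂ i, s i) := by
  classical
  rcases isEmpty_or_nonempty ι with _ | _
  · simp
  have hdir : Directed (· ⊇ ·) s := fun i j =>
    ((hs i).total (hs j)).elim (fun h => ⟨i, subset_rfl, h⟩) fun h => ⟨j, h, subset_rfl⟩
  obtain ⟨i, hi⟩ := hdir.finite_le (id : ι → ι)
  calc ∏ j, μ.real (s j) ≤ μ.real (s i) :=
        (Finset.mul_prod_erase .univ _ (Finset.mem_univ i)).symm.trans_le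
          (mul_le_of_le_one_right measureReal_nonneg
            (Finset.prod_le_one (fun _ _ => measureReal_nonneg) fun _ _ => measureReal_le_one))
    _ ≤ μ.real (⋂ j, s j) := measureReal_mono (Set.subset_iInter hi)

lemma lowerOrthantLE_diagonal_smul_vecMulVec {v : ι → ℝ} (hv : 0 ≤ v) {h : ℝ} (hh : 0 ≤ h) :
    LowerOrthantLE (h • diagonal (v ^ 2)) (h • vecMulVec v v) := by
  intro a
  lift h to NNReal using hh
  have hdiag : (h : ℝ) • diagonal (v ^ 2) = diagonal fun i => (h : ℝ) * v i ^ 2 := by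
    rw [← diagonal_smul]; rfl
  have hlaw (i : ι) : (gaussianReal 0 ((h : ℝ) * v i ^ 2).toNNReal).real (Set.Iio (a i)) =
      (gaussianReal 0 h).real {t | t * v i < a i} := by
    have hmap := gaussianReal_map_mul_const (μ := 0) (v := h) (v i)
    rw [mul_zero] at hmap
    have hvar : ((h : ℝ) * v i ^ 2).toNNReal = NNReal.mk (v i ^ 2) (sq_nonneg _) * h := by
      ext
      simp [mul_comm, mul_nonneg h.coe_nonneg (sq_nonneg (v i))]
    rw [hvar, ← hmap, map_measureReal_apply (by fun_prop) measurableSet_Iio]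
    rfl
  have hlower (i : ι) : IsLowerSet {t : ℝ | t * v i < a i} := fun t t' ht' ht =>
    (mul_le_mul_of_nonneg_right ht' (hv i)).trans_lt ht
  rw [hdiag, orthantProb_diagonal fun i => by positivity]
  simp only [hlaw]
  refine (prod_measureReal_le_measureReal_iInter hlower).trans_eq ?_
  rw [orthantProb, ← gaussianReal_map_smul_eq_multivariateGaussian,
    map_measureReal_apply (by fun_prop) (measurableSet_forall_lt (fun i => by fun_prop) a)]
  congr 1
  ext t
  simp

lemma sum_smul_vecMulVec_single_add_smul_single {E : Matrix ι ι ℝ} (hsymm : E.IsSymm) {σ : ℝ}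
    (hσ : σ ^ 2 = 1) :
    ∑ p : ι × ι, (E p.1 p.2 / 2) • vecMulVec (Pi.single p.1 1 + σ • Pi.single p.2 1)
      (Pi.single p.1 1 + σ • Pi.single p.2 1) = (diagonal fun i => ∑ j, E i j) + σ • E := by
  have hcol (k : ι) : ∑ i, E i k = ∑ j, E k j := Finset.sum_congr rfl fun i _ => hsymm.apply k i
  ext k l
  have hentry (i j : ι) : ((E i j / 2) • vecMulVec (Pi.single i 1 + σ • Pi.single j 1)
      (Pi.single i 1 + σ • Pi.single j 1)) k l =
      (if k = i then if l = i then E i j / 2 else 0 else 0) +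
      (if k = i then if l = j then σ * (E i j / 2) else 0 else 0) +
      (if l = i then if k = j then σ * (E i j / 2) else 0 else 0) +
      (if k = j then if l = j then σ ^ 2 * (E i j / 2) else 0 else 0) := by
    simp only [Matrix.smul_apply, vecMulVec_apply, Pi.add_apply, Pi.smul_apply, Pi.single_apply,
      smul_eq_mul]
    split_ifs <;> ring
  simp only [Matrix.sum_apply, Fintype.sum_prod_type, hentry, Finset.sum_add_distrib]
  rcases eq_or_ne k l with rfl | hkl
  · simp only [Finset.sum_ite_irrel, ← Finset.sum_div, Finset.sum_const_zero, Finset.sum_ite_eq,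
      Finset.mem_univ, if_true, hσ, one_mul, hcol, Matrix.add_apply, diagonal_apply_eq,
      Matrix.smul_apply, smul_eq_mul]
    ring
  · simp only [Finset.sum_ite_irrel, Finset.sum_const_zero, Finset.sum_ite_eq, Finset.mem_univ,
      if_true, hkl.symm, if_false, zero_add, hsymm.apply k l, add_zero, Matrix.add_apply,
      diagonal_apply_ne _ hkl, Matrix.smul_apply, smul_eq_mul]
    ring

lemma posSemidef_diagonal_rowSum_add_smul {E : Matrix ι ι ℝ} (hE : ∀ i j, 0 ≤ E i j)
    (hsymm : E.IsSymm) {σ : ℝ} (hσ : σ ^ 2 = 1) :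
    ((diagonal fun i => ∑ j, E i j) + σ • E).PosSemidef := by
  rw [← sum_smul_vecMulVec_single_add_smul_single hsymm hσ]
  exact posSemidef_sum _ fun p _ =>
    posSemidef_smul_vecMulVec _ (div_nonneg (hE p.1 p.2) zero_le_two)

/-- `E` is added one pair of coordinates at a time: independent noises in the two coordinates are
replaced by a common one. -/
lemma lowerOrthantLE_add_of_rowSum {S E : Matrix ι ι ℝ} (hE : ∀ i j, 0 ≤ E i j) (hsymm : E.IsSymm)
    (hdiag : ∀ i, E i i = 0) (hS : (S - diagonal fun i => ∑ j, E i j).PosSemidef) :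
    LowerOrthantLE S (S + E) := by
  let v (p : ι × ι) : ι → ℝ := Pi.single p.1 1 + Pi.single p.2 1
  have hv (p : ι × ι) : 0 ≤ v p := add_nonneg (by simp) (by simp)
  have hweight (p : ι × ι) : 0 ≤ E p.1 p.2 / 2 := div_nonneg (hE _ _) zero_le_two
  have hps (p : ι × ι) : ((E p.1 p.2 / 2) • diagonal (v p ^ 2)).PosSemidef :=
    (PosSemidef.diagonal fun i => sq_nonneg (v p i)).smul (hweight p)
  have hps' (p : ι × ι) : ((E p.1 p.2 / 2) • vecMulVec (v p) (v p)).PosSemidef :=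
    posSemidef_smul_vecMulVec _ (hweight p)
  have hpair : ∑ p : ι × ι, (E p.1 p.2 / 2) • vecMulVec (v p) (v p) =
      (diagonal fun i => ∑ j, E i j) + E := by
    simpa using sum_smul_vecMulVec_single_add_smul_single hsymm (one_pow 2)
  have hpair_diag : ∑ p : ι × ι, (E p.1 p.2 / 2) • diagonal (v p ^ 2) =
      diagonal fun i => ∑ j, E i j := by
    ext k l
    rcases eq_or_ne k l with rfl | hkl
    · simpa [Matrix.sum_apply, vecMulVec_apply, hdiag, ← sq] using congr_fun₂ hpair k k
    · simp [Matrix.sum_apply, diagonal_apply_ne _ hkl]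
  have hle := LowerOrthantLE.add hS hS (posSemidef_sum .univ fun p _ => hps p)
    (posSemidef_sum .univ fun p _ => hps' p) (fun _ => le_rfl)
    (.sum .univ hps hps' fun p => lowerOrthantLE_diagonal_smul_vecMulVec (hv p) (hweight p))
  rwa [hpair_diag, hpair, ← add_assoc, sub_add_cancel] at hle

lemma lowerOrthantLE_of_posSemidef_sub_smul_one {S T : Matrix ι ι ℝ} {c : ℝ} (hc : 0 < c)
    (hS : (S - c • (1 : Matrix ι ι ℝ)).PosSemidef) (hT : (T - c • (1 : Matrix ι ι ℝ)).PosSemidef)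
    (hdiag : ∀ i, S i i = T i i) (hle : ∀ i j, S i j ≤ T i j) : LowerOrthantLE S T := by
  obtain ⟨N, hN⟩ := exists_nat_gt ((∑ i, ∑ j, (T - S) i j) / c)
  have hE (i j : ι) : 0 ≤ (T - S) i j := sub_nonneg.2 (hle i j)
  have hN0 : 0 < (N : ℝ) := hN.trans_le' <| div_nonneg
    (Finset.sum_nonneg fun i _ => Finset.sum_nonneg fun j _ => hE i j) hc.le
  have hsymm : (T - S).IsSymm := by
    have hherm := hT.isHermitian.sub hS.isHermitian
    rw [sub_sub_sub_cancel_right] at hherm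
    simpa only [IsHermitian, IsSymm, conjTranspose_eq_transpose_of_trivial] using hherm
  have hrow (i : ι) : ∑ j, ((N : ℝ)⁻¹ • (T - S)) i j ≤ c := by
    have hrow_le : ∑ j, (T - S) i j ≤ ∑ i, ∑ j, (T - S) i j :=
      Finset.single_le_sum (f := fun i => ∑ j, (T - S) i j)
        (fun i _ => Finset.sum_nonneg fun j _ => hE i j) (Finset.mem_univ i)
    simp only [Matrix.smul_apply, smul_eq_mul, ← Finset.mul_sum]
    rw [inv_mul_le_iff₀ hN0]
    exact hrow_le.trans ((div_lt_iff₀ hc).1 hN).le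
  have hstep (k : ℕ) (hk : k ≤ N) : LowerOrthantLE S (S + (k / N : ℝ) • (T - S)) := by
    induction k with
    | zero => simp [LowerOrthantLE]
    | succ k ih =>
      have hkN : (k / N : ℝ) ≤ 1 := (div_le_one hN0).2 (by exact_mod_cast k.le_succ.trans hk)
      have hps : (S + (k / N : ℝ) • (T - S) -
          diagonal fun i => ∑ j, ((N : ℝ)⁻¹ • (T - S)) i j).PosSemidef := by
        convert ((hS.smul (sub_nonneg.2 hkN)).add (hT.smul (by positivity : 0 ≤ (k / N : ℝ)))).add
          (PosSemidef.diagonal fun i => sub_nonneg.2 (hrow i)) using 1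
        rw [← diagonal_sub, ← smul_one_eq_diagonal]
        module
      have hnext := lowerOrthantLE_add_of_rowSum (E := (N : ℝ)⁻¹ • (T - S))
        (fun i j => mul_nonneg (by positivity) (hE i j)) (hsymm.smul _) (by simp [hdiag]) hps
      have hsplit : S + ((k + 1 : ℕ) / N : ℝ) • (T - S) =
          S + (k / N : ℝ) • (T - S) + (N : ℝ)⁻¹ • (T - S) := by
        push_cast
        module
      rw [hsplit]
      exact fun a => (ih (k.le_succ.trans hk) a).trans (hnext a)
  simpa [div_self hN0.ne'] using hstep N le_rfl

/-- Slepian's inequality. -/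
theorem lowerOrthantLE_of_le {S T : Matrix ι ι ℝ} (hS : S.PosSemidef) (hT : T.PosSemidef)
    (hpos : ∀ i, 0 < S i i) (hdiag : ∀ i, S i i = T i i) (hle : ∀ i j, S i j ≤ T i j) :
    LowerOrthantLE S T := by
  intro a
  have hlim {R : Matrix ι ι ℝ} (hR : R.PosSemidef) (hRpos : ∀ i, 0 < R i i) :
      Tendsto (fun c : ℝ => orthantProb (R + c • 1) a) (𝓝[>] 0) (𝓝 (orthantProb R a)) := by
    refine (continuousWithinAt_orthantProb hR hRpos a).tendsto.comp
      (tendsto_nhdsWithin_iff.2 ⟨?_, ?_⟩)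
    · have hcont : Continuous fun c : ℝ => R + c • (1 : Matrix ι ι ℝ) := by fun_prop
      simpa using (hcont.tendsto 0).mono_left nhdsWithin_le_nhds
    · filter_upwards [self_mem_nhdsWithin] with c hc
      exact hR.add (PosSemidef.one.smul (Set.mem_Ioi.1 hc).le)
  refine le_of_tendsto_of_tendsto (hlim hS hpos) (hlim hT fun i => hdiag i ▸ hpos i) ?_
  filter_upwards [self_mem_nhdsWithin] with c hc
  exact lowerOrthantLE_of_posSemidef_sub_smul_one (S := S + c • 1) (T := T + c • 1) hc
    (by simpa using hS) (by simpa using hT) (by simp [hdiag])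
    (fun i j => by simpa using hle i j) a

section Blocks

variable {κ : Type*} [Fintype κ] [DecidableEq κ] {β : κ → Type*} [∀ k, Fintype (β k)]
  [∀ k, DecidableEq (β k)]

lemma prod_orthantProb_blockDiag'_le {S : Matrix (Σ k, β k) (Σ k, β k) ℝ} (hS : S.PosSemidef)
    (hpos : ∀ i, 0 < S i i) (hnonneg : ∀ i j, 0 ≤ S i j) (a : (Σ k, β k) → ℝ) :
    ∏ k, orthantProb (blockDiag' S k) (fun i => a ⟨k, i⟩) ≤ orthantProb S a := by
  have hblock (k : κ) : (blockDiag' S k).PosSemidef := hS.submatrix (Sigma.mk k)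
  rw [← orthantProb_blockDiagonal' hblock]
  refine lowerOrthantLE_of_le (posSemidef_blockDiagonal' hblock) hS (fun i => ?_) (fun i => ?_)
    (fun i j => ?_) a
  · simpa [blockDiagonal'_apply, blockDiag'_apply] using hpos i
  · simp [blockDiagonal'_apply, blockDiag'_apply]
  · obtain ⟨k, i⟩ := i
    obtain ⟨l, j⟩ := j
    rcases eq_or_ne k l with rfl | hkl
    · simp [blockDiagonal'_apply, blockDiag'_apply]
    · simpa [blockDiagonal'_apply, hkl] using hnonneg ⟨k, i⟩ ⟨l, j⟩

end Blocks

end Slepian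

section Density

variable {ι : Type*} [Fintype ι] [DecidableEq ι]

lemma smul_gaussianReal_le {m : ℝ} {v w : NNReal} (hv : 0 < v) (hvw : v ≤ w) :
    ENNReal.ofReal √(v / w) • gaussianReal m v ≤ gaussianReal m w := by
  have hw : 0 < w := hv.trans_le hvw
  rw [gaussianReal_of_var_ne_zero _ hv.ne', gaussianReal_of_var_ne_zero _ hw.ne',
    ← withDensity_smul _ (measurable_gaussianPDF _ _)]
  refine withDensity_mono (ae_of_all _ fun x => ?_)
  simp only [Pi.smul_apply, smul_eq_mul, gaussianPDF]
  rw [← ENNReal.ofReal_mul (Real.sqrt_nonneg _)]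
  refine ENNReal.ofReal_le_ofReal ?_
  have hcoef : √((v : ℝ) / w) * (√(2 * Real.pi * v))⁻¹ = (√(2 * Real.pi * w))⁻¹ := by
    rw [← Real.sqrt_inv, ← Real.sqrt_inv, ← Real.sqrt_mul (by positivity)]
    congr 1
    field_simp
  rw [gaussianPDFReal, gaussianPDFReal, ← mul_assoc, hcoef, neg_div, neg_div]
  gcongr

lemma prod_smul_multivariateGaussian_sum_le {κ : Type*} {S T : κ → Matrix ι ι ℝ}
    (hS : ∀ k, (S k).PosSemidef) (hT : ∀ k, (T k).PosSemidef) {c : κ → ℝ≥0∞}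
    (hle : ∀ k, c k • multivariateGaussian 0 (S k) ≤ multivariateGaussian 0 (T k)) (s : Finset κ) :
    (∏ k ∈ s, c k) • multivariateGaussian 0 (∑ k ∈ s, S k) ≤
      multivariateGaussian 0 (∑ k ∈ s, T k) := by
  classical
  induction s using Finset.induction_on with
  | empty => simp
  | insert k s hk ih =>
    have hconv {R : κ → Matrix ι ι ℝ} (hR : ∀ k, (R k).PosSemidef) :
        multivariateGaussian 0 (∑ j ∈ insert k s, R j) =
          (multivariateGaussian 0 (R k)) ∗ (multivariateGaussian 0 (∑ j ∈ s, R j)) := by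
      rw [multivariateGaussian_conv_multivariateGaussian (hR k) (posSemidef_sum s fun j _ => hR j),
        add_zero, Finset.sum_insert hk]
    rw [Finset.prod_insert hk, hconv hS, hconv hT]
    refine le_trans (le_of_eq ?_) (Measure.map_mono (Measure.prod_mono (hle k) ih) measurable_add)
    rw [Measure.prod_smul_left, Measure.prod_smul_right, smul_smul, Measure.map_smul, Measure.conv]

section Eigenbasis

variable {C : Matrix ι ι ℝ} (hC : C.IsHermitian)

lemma sum_eigenvalues_smul_vecMulVec_eigenvectorBasis :
    ∑ k, hC.eigenvalues k •
      vecMulVec (hC.eigenvectorBasis k : ι → ℝ) (hC.eigenvectorBasis k) = C := by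
  conv_rhs => rw [hC.spectral_theorem]
  ext i j
  simp only [Unitary.conjStarAlgAut_apply, Matrix.sum_apply, Matrix.smul_apply, vecMulVec_apply,
    mul_apply, diagonal_apply, Function.comp_apply, RCLike.ofReal_real_eq_id, id_eq, mul_ite,
    mul_zero, Finset.sum_ite_eq', Finset.mem_univ, if_true, star_apply, star_trivial,
    IsHermitian.eigenvectorUnitary_apply, smul_eq_mul]
  exact Finset.sum_congr rfl fun k _ => by ring

lemma sum_vecMulVec_eigenvectorBasis :
    ∑ k, vecMulVec (hC.eigenvectorBasis k : ι → ℝ) (hC.eigenvectorBasis k) = 1 := by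
  rw [← Unitary.coe_mul_star_self hC.eigenvectorUnitary]
  ext i j
  simp [Matrix.sum_apply, vecMulVec_apply, mul_apply, star_apply]

lemma eigenvalues_mem_Icc {a b : ℝ} (haC : (C - a • (1 : Matrix ι ι ℝ)).PosSemidef)
    (hCb : (b • (1 : Matrix ι ι ℝ) - C).PosSemidef) (k : ι) : hC.eigenvalues k ∈ Set.Icc a b := by
  have hnorm := hC.eigenvectorBasis.inner_eq_one k
  rw [EuclideanSpace.inner_eq_star_dotProduct, star_trivial] at hnorm
  have hlower := haC.dotProduct_mulVec_nonneg (hC.eigenvectorBasis k)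
  have hupper := hCb.dotProduct_mulVec_nonneg (hC.eigenvectorBasis k)
  simp only [sub_mulVec, hC.mulVec_eigenvectorBasis, smul_mulVec, one_mulVec, star_trivial,
    dotProduct_sub, dotProduct_smul, hnorm, smul_eq_mul, mul_one, sub_nonneg] at hlower hupper
  exact ⟨hlower, hupper⟩

end Eigenbasis

lemma pow_smul_multivariateGaussian_smul_one_le {C : Matrix ι ι ℝ} {a b : ℝ} (ha : 0 < a)
    (haC : (C - a • (1 : Matrix ι ι ℝ)).PosSemidef)
    (hCb : (b • (1 : Matrix ι ι ℝ) - C).PosSemidef) :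
    ENNReal.ofReal √(a / b) ^ Fintype.card ι • multivariateGaussian 0 (a • (1 : Matrix ι ι ℝ)) ≤
      multivariateGaussian 0 C := by
  have hC : C.IsHermitian := by
    simpa using (haC.add (PosSemidef.one.smul ha.le)).isHermitian
  let e (k : ι) : ι → ℝ := hC.eigenvectorBasis k
  have hmem := eigenvalues_mem_Icc hC haC hCb
  have hpos (k : ι) : 0 < hC.eigenvalues k := ha.trans_le (hmem k).1
  have hdirection (k : ι) :
      ENNReal.ofReal √(a / b) • multivariateGaussian 0 (a • vecMulVec (e k) (e k)) ≤
        multivariateGaussian 0 (hC.eigenvalues k • vecMulVec (e k) (e k)) := by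
    have hvar : (a.toNNReal : ℝ) = a ∧ ((hC.eigenvalues k).toNNReal : ℝ) = hC.eigenvalues k :=
      ⟨Real.coe_toNNReal _ ha.le, Real.coe_toNNReal _ (hpos k).le⟩
    have hsqrt : √(a / b) ≤ √(a / hC.eigenvalues k) :=
      Real.sqrt_le_sqrt (div_le_div_of_nonneg_left ha.le (hpos k) (hmem k).2)
    have hreal := smul_gaussianReal_le (m := 0) (Real.toNNReal_pos.2 ha)
      (Real.toNNReal_le_toNNReal (hmem k).1)
    rw [hvar.1, hvar.2] at hreal
    have hmap := Measure.map_mono hreal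
      (by fun_prop : Measurable fun t : ℝ => t • toLp 2 (e k))
    rw [Measure.map_smul, gaussianReal_map_smul_eq_multivariateGaussian,
      gaussianReal_map_smul_eq_multivariateGaussian, hvar.1, hvar.2] at hmap
    refine le_trans (fun A => ?_) hmap
    simp only [Measure.smul_apply, smul_eq_mul]
    gcongr
  have hsum := prod_smul_multivariateGaussian_sum_le
    (fun k => posSemidef_smul_vecMulVec (e k) ha.le)
    (fun k => posSemidef_smul_vecMulVec (e k) (hpos k).le) hdirection .univ
  rwa [Finset.prod_const, Finset.card_univ, ← Finset.smul_sum,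
    sum_eigenvalues_smul_vecMulVec_eigenvectorBasis, sum_vecMulVec_eigenvectorBasis] at hsum

lemma pow_mul_pow_le_orthantProb {C : Matrix ι ι ℝ} {a b : ℝ} (ha : 0 < a)
    (haC : (C - a • (1 : Matrix ι ι ℝ)).PosSemidef)
    (hCb : (b • (1 : Matrix ι ι ℝ) - C).PosSemidef) (η : ℝ) :
    (√(a / b) * (gaussianReal 0 a.toNNReal).real (Set.Iio η)) ^ Fintype.card ι ≤
      orthantProb C fun _ => η := by
  have hone : orthantProb (a • (1 : Matrix ι ι ℝ)) (fun _ => η) =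
      (gaussianReal 0 a.toNNReal).real (Set.Iio η) ^ Fintype.card ι := by
    rw [smul_one_eq_diagonal, orthantProb_diagonal fun _ => ha.le, Finset.prod_const,
      Finset.card_univ]
  have hle := pow_smul_multivariateGaussian_smul_one_le ha haC hCb {x | ∀ i, x i < η}
  rwa [Measure.smul_apply, smul_eq_mul, ← ofReal_orthantProb _ fun _ => η,
    ← ofReal_orthantProb _ fun _ => η, ← ENNReal.ofReal_pow (Real.sqrt_nonneg _),
    ← ENNReal.ofReal_mul (by positivity), ENNReal.ofReal_le_ofReal_iff (orthantProb_nonneg _ _),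
    hone, ← mul_pow] at hle

end Density

section Shift

lemma withDensity_apply_le_rpow_mul {α : Type*} [MeasurableSpace α] {μ : Measure α} {p q : ℝ}
    (hpq : p.HolderConjugate q) {f : α → ℝ≥0∞} (hf : AEMeasurable f μ) {s : Set α}
    (hs : MeasurableSet s) :
    μ.withDensity f s ≤ μ s ^ (1 / p) * (∫⁻ x, f x ^ q ∂μ) ^ (1 / q) := by
  calc μ.withDensity f s = ∫⁻ x in s, (1 * f) x ∂μ := by rw [withDensity_apply _ hs, one_mul]
    _ ≤ (∫⁻ x in s, (1 : α → ℝ≥0∞) x ^ p ∂μ) ^ (1 / p) * (∫⁻ x in s, f x ^ q ∂μ) ^ (1 / q) :=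
        ENNReal.lintegral_mul_le_Lp_mul_Lq _ hpq aemeasurable_const hf.restrict
    _ ≤ μ s ^ (1 / p) * (∫⁻ x, f x ^ q ∂μ) ^ (1 / q) := by
        gcongr
        · exact hpq.one_div_nonneg
        · simp
        · exact hpq.symm.one_div_nonneg
        · exact Measure.restrict_le_self

lemma withDensity_gaussianReal (m : ℝ) {v : NNReal} (hv : v ≠ 0) :
    (gaussianReal 0 v).withDensity (fun x => .ofReal (Real.exp ((m * x - m ^ 2 / 2) / v))) =
      gaussianReal m v := by
  rw [gaussianReal_of_var_ne_zero _ hv, gaussianReal_of_var_ne_zero _ hv, ← withDensity_mul _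
    (measurable_gaussianPDF _ _) (by fun_prop)]
  congr 1
  ext x
  rw [Pi.mul_apply, gaussianPDF, gaussianPDF, ← ENNReal.ofReal_mul (gaussianPDFReal_nonneg _ _ _),
    gaussianPDFReal, gaussianPDFReal, mul_assoc, ← Real.exp_add]
  congr 3
  field_simp
  ring

lemma lintegral_rpow_exp_gaussianReal (m q : ℝ) {v : NNReal} (hv : v ≠ 0) :
    ∫⁻ x, ENNReal.ofReal (Real.exp ((m * x - m ^ 2 / 2) / v)) ^ q ∂(gaussianReal 0 v) =
      ENNReal.ofReal (Real.exp (q * (q - 1) * m ^ 2 / (2 * v))) := by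
  have hsplit (x : ℝ) : ENNReal.ofReal (Real.exp ((m * x - m ^ 2 / 2) / v)) ^ q =
      ENNReal.ofReal (Real.exp (q * (q - 1) * m ^ 2 / (2 * v))) *
        ENNReal.ofReal (Real.exp ((q * m * x - (q * m) ^ 2 / 2) / v)) := by
    rw [ENNReal.ofReal_rpow_of_pos (Real.exp_pos _), ← ENNReal.ofReal_mul (Real.exp_nonneg _),
      ← Real.exp_mul, ← Real.exp_add]
    congr 2
    field_simp
    ring
  have hmass := congr($(withDensity_gaussianReal (q * m) hv) Set.univ)
  rw [withDensity_apply _ .univ, Measure.restrict_univ, measure_univ] at hmass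
  simp_rw [hsplit]
  rw [lintegral_const_mul _ (by fun_prop), hmass, mul_one]

variable {ι : Type*} [Fintype ι] [DecidableEq ι]

lemma orthantProb_add_smul_vecMulVec_add_smul {R : Matrix ι ι ℝ} (hR : R.PosSemidef) (h : NNReal)
    (w a : ι → ℝ) (s : ℝ) :
    orthantProb (R + (h : ℝ) • vecMulVec w w) (a + s • w) =
      ((multivariateGaussian 0 R).prod (gaussianReal (-s) h)).real
        {p | ∀ i, p.1 i + p.2 * w i < a i} := by
  have hmap := gaussianReal_map_add_const (μ := 0) (v := h) (-s)
  rw [zero_add] at hmap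
  rw [orthantProb_add_smul_vecMulVec hR, ← hmap]
  nth_rw 2 [← Measure.map_id (μ := multivariateGaussian 0 R)]
  rw [Measure.map_prod_map _ _ (by fun_prop) (by fun_prop),
    map_measureReal_apply (by fun_prop) (measurableSet_forall_lt (fun i => by fun_prop) a)]
  congr 1
  ext p
  refine forall_congr' fun i => ?_
  simp only [Pi.add_apply, Pi.smul_apply, smul_eq_mul, Prod.map_fst, Prod.map_snd, id_eq,
    ← sub_eq_add_neg, sub_mul, ← add_sub_assoc, sub_lt_iff_lt_add]

lemma orthantProb_add_smul_vecMulVec_le {R : Matrix ι ι ℝ} (hR : R.PosSemidef) {h : NNReal}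
    (hh : h ≠ 0) {p q : ℝ} (hpq : p.HolderConjugate q) (w a : ι → ℝ) (s : ℝ) :
    orthantProb (R + (h : ℝ) • vecMulVec w w) (a + s • w) ≤
      orthantProb (R + (h : ℝ) • vecMulVec w w) a ^ (1 / p) *
        Real.exp ((q - 1) * s ^ 2 / (2 * h)) := by
  let ν := (multivariateGaussian 0 R).prod (gaussianReal 0 h)
  let f (x : ℝ) : ℝ≥0∞ := .ofReal (Real.exp ((-s * x - (-s) ^ 2 / 2) / h))
  have hf : Measurable f := by fun_prop
  have hdensity : (multivariateGaussian 0 R).prod (gaussianReal (-s) h) =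
      ν.withDensity fun p => f p.2 := by
    rw [← withDensity_gaussianReal _ hh, prod_withDensity_right hf]
  have hmoment : (∫⁻ p, f p.2 ^ q ∂ν) ^ (1 / q) =
      ENNReal.ofReal (Real.exp ((q - 1) * s ^ 2 / (2 * h))) := by
    have hq := hpq.symm.ne_zero
    rw [lintegral_prod _ (by fun_prop)]
    simp only [f]
    rw [lintegral_rpow_exp_gaussianReal _ _ hh, lintegral_const, measure_univ, mul_one, neg_sq,
      ENNReal.ofReal_rpow_of_pos (Real.exp_pos _), ← Real.exp_mul]
    congr 2
    field_simp
  rw [orthantProb_add_smul_vecMulVec_add_smul hR, orthantProb_add_smul_vecMulVec hR, hdensity,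
    measureReal_def, measureReal_def, ← ENNReal.toReal_ofReal (Real.exp_nonneg _), ← hmoment,
    ENNReal.toReal_rpow, ← ENNReal.toReal_mul]
  refine ENNReal.toReal_mono (ENNReal.mul_ne_top ?_ ?_) (withDensity_apply_le_rpow_mul hpq
    (by fun_prop) (measurableSet_forall_lt (fun i => by fun_prop) a))
  · exact ENNReal.rpow_ne_top_of_nonneg hpq.one_div_nonneg (measure_ne_top _ _)
  · exact hmoment ▸ ENNReal.ofReal_ne_top

omit [DecidableEq ι] in
lemma posSemidef_sub_smul_vecMulVec_mulVec {S : Matrix ι ι ℝ} (hS : S.PosSemidef) {u : ι → ℝ}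
    (hu : u ⬝ᵥ S *ᵥ u ≠ 0) :
    (S - (u ⬝ᵥ S *ᵥ u)⁻¹ • vecMulVec (S *ᵥ u) (S *ᵥ u)).PosSemidef := by
  classical
  have hsymm : u ᵥ* S = S *ᵥ u := by
    rw [← mulVec_transpose, ← conjTranspose_eq_transpose_of_trivial, hS.isHermitian.eq]
  -- the covariance matrix of `X - ⟪u, X⟫ / Var ⟪u, X⟫ • S u`
  convert hS.conjTranspose_mul_mul_same (1 - (u ⬝ᵥ S *ᵥ u)⁻¹ • vecMulVec u (S *ᵥ u)) using 1
  simp only [conjTranspose_eq_transpose_of_trivial, transpose_sub, transpose_one, transpose_smul,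
    transpose_vecMulVec, sub_mul, mul_sub, one_mul, mul_one, smul_mul_assoc, mul_smul_comm,
    vecMulVec_mul, mul_vecMulVec, hsymm, vecMulVec_mulVec]
  rw [op_smul_eq_smul, dotProduct_comm (S *ᵥ u), smul_vecMulVec, inv_smul_smul₀ hu, sub_self,
    smul_zero, sub_zero]

/-- Cameron–Martin in the direction `S u`, followed by Hölder's inequality for the density. -/
lemma orthantProb_add_smul_mulVec_le {S : Matrix ι ι ℝ} (hS : S.PosSemidef) {p q : ℝ}
    (hpq : p.HolderConjugate q) (u a : ι → ℝ) (s : ℝ) :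
    orthantProb S (a + s • S *ᵥ u) ≤
      orthantProb S a ^ (1 / p) * Real.exp ((q - 1) * s ^ 2 * (u ⬝ᵥ S *ᵥ u) / 2) := by
  have hnonneg : 0 ≤ u ⬝ᵥ S *ᵥ u := by simpa using hS.dotProduct_mulVec_nonneg u
  rcases hnonneg.eq_or_lt with hzero | hpos
  · have hSu : S *ᵥ u = 0 := (hS.dotProduct_mulVec_zero_iff u).1 (by simpa using hzero.symm)
    simpa [hSu] using Real.self_le_rpow_of_le_one (orthantProb_nonneg S a) measureReal_le_one
      (inv_le_one_of_one_le₀ hpq.lt.le)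
  · have hshift := orthantProb_add_smul_vecMulVec_le
      (posSemidef_sub_smul_vecMulVec_mulVec hS hpos.ne')
      (h := NNReal.mk (u ⬝ᵥ S *ᵥ u)⁻¹ (inv_nonneg.2 hnonneg))
      (by simpa [← NNReal.coe_ne_zero] using hpos.ne') hpq (S *ᵥ u) a s
    simp only [NNReal.coe_mk, sub_add_cancel] at hshift
    convert hshift using 3
    field_simp

lemma orthantProb_const_add_le {S : Matrix ι ι ℝ} (hS : S.PosSemidef)
    (hrow : ∀ i, 1 ≤ ∑ j, S i j) {p q : ℝ} (hpq : p.HolderConjugate q) (r : ℝ) {η : ℝ}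
    (hη : 0 ≤ η) :
    orthantProb S (fun _ => r + η) ≤
      orthantProb S (fun _ => r) ^ (1 / p) *
        Real.exp ((q - 1) * η ^ 2 * (∑ i, ∑ j, S i j) / 2) := by
  have hS1 : S *ᵥ (fun _ => 1) = fun i => ∑ j, S i j := by
    ext i
    simp [mulVec, dotProduct]
  have hshift := orthantProb_add_smul_mulVec_le hS hpq (fun _ => 1) (fun _ => r) η
  simp only [hS1, dotProduct, one_mul] at hshift
  refine (orthantProb_mono S fun i => ?_).trans hshift
  exact add_le_add_right (le_mul_of_one_le_right hη (hrow i)) r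

end Shift

section Decoupling

section Noise

variable {ι : Type*} [Fintype ι] [DecidableEq ι]

lemma posSemidef_smul_one_add_smul {E : Matrix ι ι ℝ} (hE : ∀ i j, 0 ≤ E i j)
    (hsymm : E.IsSymm) {δ : ℝ} (hrow : ∀ i, ∑ j, E i j ≤ δ) {σ : ℝ} (hσ : σ ^ 2 = 1) :
    (δ • (1 : Matrix ι ι ℝ) + σ • E).PosSemidef := by
  have hslack : (diagonal fun i => δ - ∑ j, E i j).PosSemidef :=
    PosSemidef.diagonal fun i => sub_nonneg.2 (hrow i)
  convert hslack.add (posSemidef_diagonal_rowSum_add_smul hE hsymm hσ) using 1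
  rw [← add_assoc, diagonal_add, smul_one_eq_diagonal]
  simp only [sub_add_cancel]

/-- Adding an independent Gaussian vector with covariance `v • 1 - E` to one with covariance `S`
removes the correlations `E`. -/
lemma orthantProb_mul_pow_le_orthantProb_sub_add {S E : Matrix ι ι ℝ} (hS : S.PosSemidef)
    (hE : ∀ i j, 0 ≤ E i j) (hsymm : E.IsSymm) {δ v : ℝ} (hrow : ∀ i, ∑ j, E i j ≤ δ)
    (hδv : δ < v) (a : ι → ℝ) (η : ℝ) :
    orthantProb S a * (√((v - δ) / (v + δ)) *
        (gaussianReal 0 (v - δ).toNNReal).real (Set.Iio η)) ^ Fintype.card ι ≤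
      orthantProb (S - E + v • 1) (a + fun _ => η) := by
  have hlower : (v • (1 : Matrix ι ι ℝ) - E - (v - δ) • 1).PosSemidef := by
    convert posSemidef_smul_one_add_smul hE hsymm hrow (neg_one_sq (R := ℝ)) using 1
    module
  have hupper : ((v + δ) • (1 : Matrix ι ι ℝ) - (v • 1 - E)).PosSemidef := by
    convert posSemidef_smul_one_add_smul hE hsymm hrow (one_pow 2) using 1
    module
  have hnoise : (v • (1 : Matrix ι ι ℝ) - E).PosSemidef := by
    simpa using hlower.add (PosSemidef.one.smul (sub_nonneg.2 hδv.le))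
  calc _ ≤ orthantProb S a * orthantProb (v • 1 - E) fun _ => η := by
        gcongr
        · exact orthantProb_nonneg S a
        · exact pow_mul_pow_le_orthantProb (sub_pos.2 hδv) hlower hupper η
    _ ≤ orthantProb (S + (v • 1 - E)) (a + fun _ => η) :=
        orthantProb_mul_le_orthantProb_add hS hnoise _ _
    _ = _ := by rw [← add_sub_assoc, sub_add_eq_add_sub]

lemma orthantProb_add_smul_one_le {D : Matrix ι ι ℝ} (hD : D.PosSemidef)
    (hdiag : ∀ i, D i i = 1) (hnonneg : ∀ i j, 0 ≤ D i j) {v : ℝ} (hv : 0 ≤ v) (t : ℝ) :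
    orthantProb (D + v • 1) (fun _ => t) ≤ orthantProb D fun _ => t / √(1 + v) := by
  have hv1 : 0 < 1 + v := by positivity
  have hps : ((1 + v)⁻¹ • (D + v • (1 : Matrix ι ι ℝ))).PosSemidef :=
    (hD.add (PosSemidef.one.smul hv)).smul (by positivity)
  have hunit (i : ι) : ((1 + v)⁻¹ • (D + v • (1 : Matrix ι ι ℝ))) i i = 1 := by
    simp [hdiag, hv1.ne']
  have hscale : orthantProb (D + v • 1) (fun _ => t) =
      orthantProb ((1 + v)⁻¹ • (D + v • 1)) fun _ => t / √(1 + v) := by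
    rw [← orthantProb_sq_smul hps (Real.sqrt_pos.2 hv1), Real.sq_sqrt hv1.le,
      smul_inv_smul₀ hv1.ne']
    congr 1
    ext
    exact (mul_div_cancel₀ t (Real.sqrt_pos.2 hv1).ne').symm
  rw [hscale]
  refine lowerOrthantLE_of_le hps hD (fun i => by simp [hunit]) (fun i => by rw [hunit, hdiag])
    (fun i j => ?_) _
  rcases eq_or_ne i j with rfl | hij
  · rw [hunit, hdiag]
  · simpa [hij] using mul_le_of_le_one_left (hnonneg i j) (inv_le_one_of_one_le₀ (by linarith))

end Noise

variable {κ : Type*} [DecidableEq κ] {β : κ → Type*}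

lemma blockDiagonal'_blockDiag'_apply (S : Matrix (Σ k, β k) (Σ k, β k) ℝ) (p q : Σ k, β k) :
    blockDiagonal' (blockDiag' S) p q = if p.1 = q.1 then S p q else 0 := by
  obtain ⟨k, i⟩ := p
  obtain ⟨l, j⟩ := q
  rcases eq_or_ne k l with rfl | hkl
  · simp [blockDiag'_apply]
  · simp [blockDiagonal'_apply, hkl]

variable [Fintype κ] [∀ k, Fintype (β k)] [∀ k, DecidableEq (β k)]

lemma orthantProb_mul_pow_le_prod_orthantProb_blockDiag' {S : Matrix (Σ k, β k) (Σ k, β k) ℝ}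
    (hS : S.PosSemidef) (hdiag : ∀ p, S p p = 1) (hnonneg : ∀ p q, 0 ≤ S p q) {δ v : ℝ}
    (hv : 0 ≤ v) (hδv : δ < v) (hrow : ∀ p, ∑ q with p.1 ≠ q.1, S p q ≤ δ) (r η : ℝ) :
    orthantProb S (fun _ => r) * (√((v - δ) / (v + δ)) *
        (gaussianReal 0 (v - δ).toNNReal).real (Set.Iio η)) ^ Fintype.card (Σ k, β k) ≤
      ∏ k, orthantProb (blockDiag' S k) fun _ => (r + η) / √(1 + v) := by
  set D := blockDiagonal' (blockDiag' S) with hDdef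
  have hblock (k : κ) : (blockDiag' S k).PosSemidef := hS.submatrix (Sigma.mk k)
  have hD : D.PosSemidef := posSemidef_blockDiagonal' hblock
  have hE (p q : Σ k, β k) : (S - D) p q = if p.1 ≠ q.1 then S p q else 0 := by
    rw [Matrix.sub_apply, hDdef, blockDiagonal'_blockDiag'_apply]
    by_cases h : p.1 = q.1 <;> simp [h]
  have hEsymm : (S - D).IsSymm :=
    (conjTranspose_eq_transpose_of_trivial _).symm.trans (hS.isHermitian.sub hD.isHermitian)
  calc _ ≤ orthantProb (S - (S - D) + v • 1) ((fun _ => r) + fun _ => η) := by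
        refine orthantProb_mul_pow_le_orthantProb_sub_add hS (fun p q => ?_) hEsymm
          (fun p => ?_) hδv _ η
        · rw [hE]
          split_ifs
          exacts [hnonneg p q, le_rfl]
        · simpa only [hE, Finset.sum_filter] using hrow p
    _ = orthantProb (D + v • 1) fun _ => r + η := by rw [sub_sub_cancel]; rfl
    _ ≤ orthantProb D fun _ => (r + η) / √(1 + v) := by
        refine orthantProb_add_smul_one_le hD (fun p => ?_) (fun p q => ?_) hv _
        · rw [hDdef, blockDiagonal'_blockDiag'_apply, if_pos rfl, hdiag]
        · rw [hDdef, blockDiagonal'_blockDiag'_apply]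
          split_ifs
          exacts [hnonneg p q, le_rfl]
    _ = _ := orthantProb_blockDiagonal' hblock _

end Decoupling

section Windows

/-- The matrix of the correlations `A` between the times `f i`. -/
def corrMatrix {ι : Type*} (A : ℕ+ → ℕ+ → ℝ) (f : ι → ℕ+) : Matrix ι ι ℝ :=
  Matrix.of fun i j => A (f i) (f j)

/-- The window of the `M` consecutive times `s + 1, …, s + M`. -/
def window (s M : ℕ) (i : Fin M) : ℕ+ := (s + i).succPNat

/-- The probability that a centered Gaussian process with correlations `A` stays below the level
`r` during the window `s + 1, …, s + M`. -/
noncomputable def windowProb (A : ℕ+ → ℕ+ → ℝ) (r : ℝ) (s M : ℕ) : ℝ :=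
  orthantProb (corrMatrix A (window s M)) fun _ => r

lemma coe_window (s M : ℕ) (i : Fin M) : (window s M i : ℕ) = s + i + 1 := rfl

lemma window_injective (s M : ℕ) : Function.Injective (window s M) := fun i j hij => by
  have := congrArg PNat.val hij
  simp only [coe_window] at this
  omega

lemma windowProb_zero (A : ℕ+ → ℕ+ → ℝ) (r : ℝ) (s : ℕ) : windowProb A r s 0 = 1 := by
  simp [windowProb, orthantProb]

lemma mem_range_window {s M : ℕ} {t : ℕ+} :
    t ∈ Set.range (window s M) ↔ s < t ∧ (t : ℕ) ≤ s + M := by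
  constructor
  · rintro ⟨i, rfl⟩
    have := i.2
    rw [coe_window]
    omega
  · rintro ⟨hst, htM⟩
    refine ⟨⟨t - s - 1, by omega⟩, PNat.eq ?_⟩
    rw [coe_window]
    dsimp only
    omega

/-- `q` windows of length `M`, starting every `G` time steps. -/
def spacedWindows (q M G : ℕ) (p : Σ _ : Fin q, Fin M) : ℕ+ := window (p.1 * G) M p.2

lemma coe_spacedWindows_add_lt {q M L : ℕ} {p p' : Σ _ : Fin q, Fin M} (hp : p.1 < p'.1) :
    (spacedWindows q M (M + L) p : ℕ) + L < spacedWindows q M (M + L) p' := by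
  have hstart : ((p.1 : ℕ) + 1) * (M + L) ≤ p'.1 * (M + L) := Nat.mul_le_mul_right _ hp
  have hlast := p.2.2
  simp only [spacedWindows, coe_window]
  rw [add_mul] at hstart
  omega

lemma coe_spacedWindows_le {q M L : ℕ} (p : Σ _ : Fin q, Fin M) :
    (spacedWindows q M (M + L) p : ℕ) ≤ q * (M + L) := by
  have hend : ((p.1 : ℕ) + 1) * (M + L) ≤ q * (M + L) := Nat.mul_le_mul_right _ p.1.2
  have hlast := p.2.2
  simp only [spacedWindows, coe_window]
  rw [add_mul] at hend
  omega

lemma le_dist_spacedWindows {q M L : ℕ} {p p' : Σ _ : Fin q, Fin M} (hp : p.1 ≠ p'.1) :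
    L ≤ Nat.dist (spacedWindows q M (M + L) p) (spacedWindows q M (M + L) p') := by
  rcases lt_or_gt_of_ne hp with h | h <;>
  · have := coe_spacedWindows_add_lt (L := L) h
    simp only [Nat.dist]
    omega

lemma spacedWindows_injective (q M L : ℕ) : Function.Injective (spacedWindows q M (M + L)) := by
  rintro ⟨k, i⟩ ⟨k', i'⟩ heq
  have heq' := congrArg PNat.val heq
  rcases lt_trichotomy k k' with h | rfl | h
  · have := coe_spacedWindows_add_lt (L := L) (p := ⟨k, i⟩) (p' := ⟨k', i'⟩) h
    omega
  · change (k * (M + L) + i + 1 : ℕ) = k * (M + L) + i' + 1 at heq'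
    rw [Fin.ext (by omega : (i : ℕ) = i')]
  · have := coe_spacedWindows_add_lt (L := L) (p := ⟨k', i'⟩) (p' := ⟨k, i⟩) h
    omega

namespace IsCenteredGaussianWithCorr

variable {Ω : Type*} [MeasurableSpace Ω] {P : Measure Ω} {Z : ℕ+ → Ω → ℝ} {A : ℕ+ → ℕ+ → ℝ}
  (h : IsCenteredGaussianWithCorr P Z A)

include h

lemma corr_self (t : ℕ+) : A t t = 1 := by
  rw [← h.corr, covariance_self (h.gaussian.aemeasurable t), h.unit_variance]

lemma corr_comm (s t : ℕ+) : A s t = A t s := by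
  rw [← h.corr, ← h.corr, covariance_comm]

lemma persistenceProb_le_one (r : ℝ) (n : ℕ) : persistenceProb P Z r n ≤ 1 := by
  have := h.gaussian.isProbabilityMeasure
  exact measureReal_le_one

lemma persistenceProb_antitone (r : ℝ) : Antitone (persistenceProb P Z r) := by
  have := h.gaussian.isProbabilityMeasure
  exact fun m n hmn => measureReal_mono fun ω hω i hi => hω i (hi.trans hmn)

variable {ι : Type*}

lemma hasGaussianLaw_comp [Finite ι] (f : ι → ℕ+) : HasGaussianLaw (fun ω i => Z (f i) ω) P := by
  have := Fintype.ofFinite ι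
  exact ((h.gaussian.comp_right f).hasGaussianLaw Finset.univ).map (ContinuousLinearMap.pi
    fun i : ι => ContinuousLinearMap.proj (R := ℝ)
      (φ := fun _ : (Finset.univ : Finset ι) => ℝ) ⟨i, Finset.mem_univ i⟩)

lemma posSemidef_corrMatrix [Finite ι] (f : ι → ℕ+) : (corrMatrix A f).PosSemidef := by
  have := h.gaussian.isProbabilityMeasure
  exact posSemidef_of_covariance_eq
    (fun i => (h.gaussian.hasGaussianLaw_eval (f i)).memLp_two) fun _ _ => h.corr _ _

variable [Fintype ι] [DecidableEq ι]

lemma measureReal_forall_lt_eq (f : ι → ℕ+) (r : ℝ) :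
    P.real {ω | ∀ i, Z (f i) ω < r} = orthantProb (corrMatrix A f) fun _ => r :=
  measureReal_forall_lt_eq_orthantProb (h.hasGaussianLaw_comp f) (fun _ => h.centered _)
    (fun _ _ => h.corr _ _) _

lemma orthantProb_corrMatrix_anti {ι' : Type*} [Fintype ι'] [DecidableEq ι'] {f : ι → ℕ+}
    {g : ι' → ℕ+} (hgf : Set.range g ⊆ Set.range f) (r : ℝ) :
    orthantProb (corrMatrix A f) (fun _ => r) ≤ orthantProb (corrMatrix A g) fun _ => r := by
  have := h.gaussian.isProbabilityMeasure
  rw [← h.measureReal_forall_lt_eq, ← h.measureReal_forall_lt_eq]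
  refine measureReal_mono fun ω hω j => ?_
  obtain ⟨i, hi⟩ := hgf ⟨j, rfl⟩
  exact hi ▸ hω i

omit [Fintype ι] [DecidableEq ι]

lemma persistenceProb_eq_windowProb (r : ℝ) (n : ℕ) :
    persistenceProb P Z r n = windowProb A r 0 n := by
  rw [windowProb, ← h.measureReal_forall_lt_eq, persistenceProb]
  congr 1
  ext ω
  have hrange (t : ℕ+) : t ∈ Set.range (window 0 n) ↔ (t : ℕ) ≤ n := by
    rw [mem_range_window]
    simp
  simp only [Set.mem_ofPred_eq, ← hrange, Set.forall_mem_range]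

lemma windowProb_mul_le (r : ℝ) (s M N : ℕ) :
    windowProb A r s M * windowProb A r (s + M) N ≤ windowProb A r s (M + N) := by
  let f (p : Σ b : Bool, Fin (if b then M else N)) : ℕ+ :=
    window (if p.1 then s else s + M) _ p.2
  have hrange : Set.range (window s (M + N)) ⊆ Set.range f := by
    intro t ht
    rw [mem_range_window] at ht
    rcases le_or_gt (t : ℕ) (s + M) with htM | htM
    · obtain ⟨i, hi⟩ := mem_range_window.2 ⟨ht.1, htM⟩
      exact ⟨⟨true, i⟩, hi⟩
    · obtain ⟨i, hi⟩ := mem_range_window.2 ⟨htM, (by omega : (t : ℕ) ≤ s + M + N)⟩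
      exact ⟨⟨false, i⟩, hi⟩
  have hsplit := prod_orthantProb_blockDiag'_le (h.posSemidef_corrMatrix f)
    (fun p => one_pos.trans_eq (h.corr_self (f p)).symm) (fun _ _ => h.nonneg _ _) fun _ => r
  rw [Fintype.prod_bool] at hsplit
  exact hsplit.trans (h.orthantProb_corrMatrix_anti hrange r)

lemma windowProb_one (r : ℝ) (s : ℕ) :
    windowProb A r s 1 = (gaussianReal 0 1).real (Set.Iio r) := by
  have hone : corrMatrix A (window s 1) = diagonal fun _ => 1 := by
    ext i j
    rw [Subsingleton.elim i j, diagonal_apply_eq]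
    exact h.corr_self _
  rw [windowProb, hone, orthantProb_diagonal fun _ => zero_le_one]
  simp

lemma pow_le_windowProb {M : ℕ} {c r : ℝ} (hc : 0 ≤ c) (hblock : ∀ s, c ≤ windowProb A r s M)
    (s q : ℕ) : c ^ q ≤ windowProb A r s (q * M) := by
  induction q with
  | zero => rw [pow_zero, Nat.zero_mul, windowProb_zero]
  | succ q ih =>
    rw [pow_succ, Nat.succ_mul]
    exact (mul_le_mul ih (hblock _) hc (orthantProb_nonneg _ _)).trans (h.windowProb_mul_le ..)

lemma persistenceProb_pos (r : ℝ) (n : ℕ) : 0 < persistenceProb P Z r n := by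
  have hpos : 0 < (gaussianReal 0 1).real (Set.Iio r) := by
    refine ENNReal.toReal_pos (fun hnull => ?_) (measure_ne_top _ _)
    simpa using gaussianReal_absolutelyContinuous' 0 one_ne_zero hnull
  rw [h.persistenceProb_eq_windowProb, ← mul_one n]
  exact (pow_pos hpos n).trans_le
    (h.pow_le_windowProb hpos.le (fun s => (h.windowProb_one r s).ge) 0 n)

lemma persistenceProb_mul_pow_le {M L q n : ℕ} (hq : q * (M + L) ≤ n) {δ v : ℝ} (hv : 0 ≤ v)
    (hδv : δ < v) (hrow : ∀ p, ∑ p' with p.1 ≠ p'.1,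
      corrMatrix A (spacedWindows q M (M + L)) p p' ≤ δ) (r η : ℝ) {c : ℝ}
    (hblock : ∀ s, windowProb A ((r + η) / √(1 + v)) s M ≤ c) :
    persistenceProb P Z r n * (√((v - δ) / (v + δ)) *
        (gaussianReal 0 (v - δ).toNNReal).real (Set.Iio η)) ^ (q * M) ≤ c ^ q := by
  set f := spacedWindows q M (M + L)
  have hrange : Set.range f ⊆ Set.range (window 0 n) := by
    rintro _ ⟨p, rfl⟩
    rw [mem_range_window, zero_add]
    exact ⟨PNat.pos _, (coe_spacedWindows_le p).trans hq⟩
  have hdecouple := orthantProb_mul_pow_le_prod_orthantProb_blockDiag'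
    (h.posSemidef_corrMatrix f) (fun p => h.corr_self _) (fun _ _ => h.nonneg _ _) hv hδv
    hrow r η
  rw [Fintype.card_sigma, Fin.sum_const, Fintype.card_fin, smul_eq_mul] at hdecouple
  calc _ ≤ _ := by
        rw [h.persistenceProb_eq_windowProb]
        gcongr
        exact h.orthantProb_corrMatrix_anti hrange r
    _ ≤ _ := hdecouple
    _ ≤ ∏ _ : Fin q, c := Finset.prod_le_prod (fun _ _ => orthantProb_nonneg _ _)
        fun k _ => hblock (k * (M + L))
    _ = c ^ q := by simp

end IsCenteredGaussianWithCorr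

end Windows

section SupCorr

lemma sum_dist_le_two_mul_tsum {ι : Type*} {F : Finset ι} {f : ι → ℕ} (hf : Set.InjOn f F)
    {s L : ℕ} (hL : ∀ i ∈ F, L ≤ Nat.dist s (f i)) (g : ℕ → ℝ≥0∞) :
    ∑ i ∈ F, g (Nat.dist s (f i)) ≤ 2 * ∑' j, g (L + j) := by
  have hside {G : Finset ι} (hGL : ∀ i ∈ G, L ≤ Nat.dist s (f i))
      (hG : Set.InjOn (fun i => Nat.dist s (f i)) G) :
      ∑ i ∈ G, g (Nat.dist s (f i)) ≤ ∑' j, g (L + j) := by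
    classical
    have hinj : Set.InjOn (fun i => Nat.dist s (f i) - L) G := fun i hi j hj hij =>
      hG hi hj ((tsub_left_inj (hGL i hi) (hGL j hj)).1 hij)
    calc ∑ i ∈ G, g (Nat.dist s (f i)) = ∑ i ∈ G, g (L + (Nat.dist s (f i) - L)) :=
          Finset.sum_congr rfl fun i hi => by rw [Nat.add_sub_of_le (hGL i hi)]
      _ = ∑ j ∈ G.image fun i => Nat.dist s (f i) - L, g (L + j) :=
          (Finset.sum_image (f := fun j => g (L + j)) hinj).symm
      _ ≤ ∑' j, g (L + j) := ENNReal.sum_le_tsum _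
  rw [← Finset.sum_filter_add_sum_filter_not F (fun i => s ≤ f i), two_mul]
  refine add_le_add (hside (fun i hi => hL i (Finset.mem_filter.1 hi).1) fun i hi j hj hij => ?_)
    (hside (fun i hi => hL i (Finset.mem_filter.1 hi).1) fun i hi j hj hij => ?_)
  all_goals
    rw [Finset.mem_coe, Finset.mem_filter] at hi hj
    simp only [Nat.dist] at hij
    exact hf hi.1 hj.1 (by omega)

lemma dist_shift (s : ℕ+) (τ : ℕ) : Nat.dist s (shift s τ) = τ := by
  simp only [shift, PNat.mk_coe, Nat.dist]
  omega

lemma shift_dist {s t : ℕ+} (hst : s ≤ t) : shift s (Nat.dist s t) = t := by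
  have : (s : ℕ) ≤ t := hst
  apply PNat.eq
  simp only [shift, PNat.mk_coe, Nat.dist]
  omega

/-- The correlation function of a stationary process, as a function of two times. -/
def stationaryCorr (a : ℕ → ℝ) (s t : ℕ+) : ℝ := a (Nat.dist s t)

lemma supCorr_stationaryCorr (a : ℕ → ℝ) (τ : ℕ) :
    supCorr (stationaryCorr a) τ = ENNReal.ofReal (a τ) := by
  simp [supCorr, stationaryCorr, dist_shift]

namespace IsCenteredGaussianWithCorr

variable {Ω : Type*} [MeasurableSpace Ω] {P : Measure Ω} {Z : ℕ+ → Ω → ℝ} {A : ℕ+ → ℕ+ → ℝ}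
  (h : IsCenteredGaussianWithCorr P Z A)

include h

lemma ofReal_corr_le_supCorr (s t : ℕ+) : ENNReal.ofReal (A s t) ≤ supCorr A (Nat.dist s t) := by
  wlog hst : s ≤ t generalizing s t
  · rw [h.corr_comm, Nat.dist_comm]
    exact this t s (le_of_not_ge hst)
  · refine le_of_eq_of_le ?_ (le_iSup _ s)
    rw [shift_dist hst]

lemma sum_corr_le {δ : ℝ} (hδ : 0 ≤ δ) {L : ℕ}
    (hL : 2 * ∑' i, supCorr A (L + i) ≤ ENNReal.ofReal δ) (s : ℕ+) {ι : Type*} {F : Finset ι}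
    {f : ι → ℕ+} (hf : Function.Injective f) (hF : ∀ i ∈ F, L ≤ Nat.dist s (f i)) :
    ∑ i ∈ F, A s (f i) ≤ δ := by
  rw [← ENNReal.ofReal_le_ofReal_iff hδ, ENNReal.ofReal_sum_of_nonneg fun _ _ => h.nonneg _ _]
  exact (Finset.sum_le_sum fun i _ => h.ofReal_corr_le_supCorr s (f i)).trans
    ((sum_dist_le_two_mul_tsum (PNat.coe_injective.comp hf).injOn hF _).trans hL)

lemma sum_corrMatrix_spacedWindows_le {δ : ℝ} (hδ : 0 ≤ δ) {L : ℕ}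
    (hL : 2 * ∑' i, supCorr A (L + i) ≤ ENNReal.ofReal δ) (q M : ℕ) (p : Σ _ : Fin q, Fin M) :
    ∑ p' with p.1 ≠ p'.1, corrMatrix A (spacedWindows q M (M + L)) p p' ≤ δ :=
  h.sum_corr_le hδ hL _ (spacedWindows_injective q M L) fun _ hp' =>
    le_dist_spacedWindows (Finset.mem_filter.1 hp').2

lemma sum_corrMatrix_le (hsum : ∑' τ, supCorr A τ ≠ ∞) {ι : Type*} [Fintype ι] {f : ι → ℕ+}
    (hf : Function.Injective f) :
    ∑ i, ∑ j, corrMatrix A f i j ≤ Fintype.card ι * (2 * ∑' τ, supCorr A τ).toReal := by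
  have hL : 2 * ∑' τ, supCorr A (0 + τ) ≤ ENNReal.ofReal (2 * ∑' τ, supCorr A τ).toReal := by
    rw [ENNReal.ofReal_toReal (ENNReal.mul_ne_top (by simp) hsum)]
    simp
  calc ∑ i, ∑ j, corrMatrix A f i j ≤ ∑ _ : ι, (2 * ∑' τ, supCorr A τ).toReal :=
        Finset.sum_le_sum fun i _ => h.sum_corr_le ENNReal.toReal_nonneg hL (f i) hf (by simp)
    _ = _ := by simp

end IsCenteredGaussianWithCorr

end SupCorr

section Convergence

lemma windowProb_stationaryCorr (a : ℕ → ℝ) (r : ℝ) (s M : ℕ) :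
    windowProb (stationaryCorr a) r s M = windowProb (stationaryCorr a) r 0 M := by
  have hdist (i j : Fin M) :
      Nat.dist (window s M i) (window s M j) = Nat.dist (window 0 M i) (window 0 M j) := by
    simp only [coe_window, Nat.dist]
    omega
  simp only [windowProb, corrMatrix, stationaryCorr, hdist]

variable {κ : Type*} {l : Filter κ} {A : κ → ℕ+ → ℕ+ → ℝ} {a : ℕ → ℝ}

lemma tsum_supCorr_stationaryCorr_le [l.NeBot]
    (hconv : ∀ τ, TendstoUniformly (fun k s => A k s (shift s τ)) (fun _ => a τ) l) {L : ℕ}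
    {c : ℝ≥0∞} (hc : ∀ᶠ k in l, ∑' i, supCorr (A k) (L + i) ≤ c) :
    ∑' i, supCorr (stationaryCorr a) (L + i) ≤ c := by
  simp only [supCorr_stationaryCorr]
  refine ENNReal.tsum_le_of_sum_range_le fun N => ?_
  have hlim : Tendsto (fun k => ∑ i ∈ Finset.range N, ENNReal.ofReal (A k 1 (shift 1 (L + i)))) l
      (𝓝 (∑ i ∈ Finset.range N, ENNReal.ofReal (a (L + i)))) :=
    tendsto_finsetSum _ fun i _ => ENNReal.tendsto_ofReal ((hconv (L + i)).tendsto_at 1)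
  refine le_of_tendsto hlim (hc.mono fun k hk => le_trans ?_ hk)
  exact (Finset.sum_le_sum fun i _ =>
    le_iSup (fun s => ENNReal.ofReal (A k s (shift s (L + i)))) 1).trans (ENNReal.sum_le_tsum _)

variable {Ω : κ → Type*} [∀ k, MeasurableSpace (Ω k)] {P : ∀ k, Measure (Ω k)}
  {Z : ∀ k, ℕ+ → Ω k → ℝ} {Ω' : Type*} [MeasurableSpace Ω'] {P' : Measure Ω'}
  {Z' : ℕ+ → Ω' → ℝ}

lemma tendstoUniformly_corr (hZ : ∀ k, IsCenteredGaussianWithCorr (P k) (Z k) (A k))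
    (hconv : ∀ τ, TendstoUniformly (fun k s => A k s (shift s τ)) (fun _ => a τ) l) {M : ℕ}
    (i j : Fin M) :
    TendstoUniformly (fun k s => A k (window s M i) (window s M j))
      (fun _ => stationaryCorr a (window 0 M i) (window 0 M j)) l := by
  wlog hij : i ≤ j generalizing i j
  · simpa only [(hZ _).corr_comm _ (window _ M j), stationaryCorr, Nat.dist_comm] using
      this j i (le_of_not_ge hij)
  have hdist (s : ℕ) : Nat.dist (window s M i) (window s M j) =
      Nat.dist (window 0 M i) (window 0 M j) := by
    simp only [coe_window, Nat.dist]
    omega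
  have hshift (s : ℕ) :
      shift (window s M i) (Nat.dist (window 0 M i) (window 0 M j)) = window s M j := by
    rw [← hdist s]
    exact shift_dist (Nat.succPNat_le_succPNat.2 (Nat.add_le_add_left hij s))
  simpa only [Function.comp_def, hshift, stationaryCorr] using
    (hconv (Nat.dist (window 0 M i) (window 0 M j))).comp fun s => window s M i

lemma tendsto_windowProb (hZ : ∀ k, IsCenteredGaussianWithCorr (P k) (Z k) (A k))
    (hZ' : IsCenteredGaussianWithCorr P' Z' (stationaryCorr a))
    (hconv : ∀ τ, TendstoUniformly (fun k s => A k s (shift s τ)) (fun _ => a τ) l)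
    (r : ℝ) (M : ℕ) :
    Tendsto (fun p : κ × ℕ => windowProb (A p.1) r p.2 M) (l ×ˢ ⊤)
      (𝓝 (windowProb (stationaryCorr a) r 0 M)) := by
  have hmatrix : Tendsto (fun p : κ × ℕ => corrMatrix (A p.1) (window p.2 M)) (l ×ˢ ⊤)
      (𝓝 (corrMatrix (stationaryCorr a) (window 0 M))) :=
    tendsto_pi_nhds.2 fun i => tendsto_pi_nhds.2 fun j =>
      tendsto_prod_top_iff.2 (tendstoUniformly_corr hZ hconv i j)
  exact (continuousWithinAt_orthantProb (hZ'.posSemidef_corrMatrix _)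
    (fun i => one_pos.trans_eq (hZ'.corr_self _).symm) _).tendsto.comp
      (tendsto_nhdsWithin_iff.2 ⟨hmatrix, .of_forall fun p => (hZ p.1).posSemidef_corrMatrix _⟩)

end Convergence

section PersistenceExponent

variable {Ω : Type*} [MeasurableSpace Ω] {P : Measure Ω} {Z : ℕ+ → Ω → ℝ}

/-- The persistence exponent `θ`, for which `P(sup_{1 ≤ i ≤ n} Z(i) < r) = exp (-θ n + o(n))` when
`Z` is stationary. It is defined as the infimum, rather than the limit, of `-log P(⋯) / n`. -/
noncomputable def persistenceExponent (P : Measure Ω) (Z : ℕ+ → Ω → ℝ) (r : ℝ) : ℝ :=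
  sInf ((fun n : ℕ => -Real.log (persistenceProb P Z r n) / n) '' Set.Ici 1)

namespace IsCenteredGaussianWithCorr

variable {A : ℕ+ → ℕ+ → ℝ} (h : IsCenteredGaussianWithCorr P Z A)

include h

lemma neg_log_persistenceProb_div_nonneg (r : ℝ) (n : ℕ) :
    0 ≤ -Real.log (persistenceProb P Z r n) / n :=
  div_nonneg (neg_nonneg.2 (Real.log_nonpos (h.persistenceProb_pos r n).le
    (h.persistenceProb_le_one r n))) n.cast_nonneg

lemma persistenceExponent_nonneg (r : ℝ) : 0 ≤ persistenceExponent P Z r := by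
  refine Real.sInf_nonneg ?_
  rintro _ ⟨n, -, rfl⟩
  exact h.neg_log_persistenceProb_div_nonneg r n

lemma persistenceProb_le_exp (r : ℝ) (n : ℕ) :
    persistenceProb P Z r n ≤ Real.exp (-(persistenceExponent P Z r * n)) := by
  rcases n.eq_zero_or_pos with rfl | hn
  · simpa using h.persistenceProb_le_one r 0
  have hbdd : BddBelow ((fun n : ℕ => -Real.log (persistenceProb P Z r n) / n) '' Set.Ici 1) :=
    ⟨0, by rintro _ ⟨n, -, rfl⟩; exact h.neg_log_persistenceProb_div_nonneg r n⟩
  have hle : persistenceExponent P Z r ≤ -Real.log (persistenceProb P Z r n) / n :=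
    csInf_le hbdd ⟨n, hn, rfl⟩
  rw [← Real.log_le_iff_le_exp (h.persistenceProb_pos r n), le_neg]
  exact (le_div_iff₀ (by exact_mod_cast hn)).1 hle

lemma exists_exp_lt_persistenceProb {r θ : ℝ} (hθ : persistenceExponent P Z r < θ) :
    ∃ M : ℕ, 0 < M ∧ Real.exp (-(θ * M)) < persistenceProb P Z r M := by
  obtain ⟨_, ⟨M, hM, rfl⟩, hlt⟩ := exists_lt_of_csInf_lt (Set.nonempty_Ici.image _) hθ
  refine ⟨M, hM, ?_⟩
  rw [← Real.lt_log_iff_exp_lt (h.persistenceProb_pos r M), neg_lt]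
  exact (div_lt_iff₀ (by exact_mod_cast hM)).1 hlt

lemma persistenceProb_mono_threshold (n : ℕ) : Monotone fun r => persistenceProb P Z r n := by
  have := h.gaussian.isProbabilityMeasure
  exact fun r r' hr => measureReal_mono fun ω hω i hi => (hω i hi).trans_le hr

end IsCenteredGaussianWithCorr

lemma exists_holderConjugate_lt_div_sub {x y : ℝ} (hxy : x < y) (B : ℝ) :
    ∃ p q : ℝ, p.HolderConjugate q ∧ ∃ η > 0, x < y / p - (q - 1) * η ^ 2 * B / 2 := by
  obtain ⟨p, hxp, hp⟩ : ∃ p, x < y / p ∧ 1 < p := by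
    have hlim : Tendsto (fun p : ℝ => y / p) (𝓝[>] 1) (𝓝 (y / 1)) :=
      (tendsto_const_nhds.div tendsto_id one_ne_zero).mono_left nhdsWithin_le_nhds
    exact ((hlim.eventually_const_lt (by rwa [div_one])).and self_mem_nhdsWithin).exists
  set q := p.conjExponent
  have hlim : Tendsto (fun η : ℝ => y / p - (q - 1) * η ^ 2 * B / 2) (𝓝[>] 0)
      (𝓝 (y / p - (q - 1) * 0 ^ 2 * B / 2)) :=
    (Continuous.tendsto (by fun_prop) 0).mono_left nhdsWithin_le_nhds
  obtain ⟨η, hxη, hη⟩ :=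
    ((hlim.eventually_const_lt (by simpa using hxp)).and self_mem_nhdsWithin).exists
  exact ⟨p, q, .conjExponent hp, η, hη, hxη⟩

namespace IsStationaryCenteredGaussianWithCorr

variable {a : ℕ → ℝ} (h : IsStationaryCenteredGaussianWithCorr P Z a)

include h

lemma isCenteredGaussianWithCorr : IsCenteredGaussianWithCorr P Z (stationaryCorr a) := h

lemma subadditive_neg_log_persistenceProb (r : ℝ) :
    Subadditive fun n => -Real.log (persistenceProb P Z r n) := by
  intro m n
  have hpos := h.isCenteredGaussianWithCorr.persistenceProb_pos r
  rw [← neg_add, neg_le_neg_iff, ← Real.log_mul (hpos m).ne' (hpos n).ne']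
  refine Real.log_le_log (mul_pos (hpos m) (hpos n)) ?_
  simp only [h.isCenteredGaussianWithCorr.persistenceProb_eq_windowProb]
  rw [← windowProb_stationaryCorr a r (0 + m) n]
  exact h.isCenteredGaussianWithCorr.windowProb_mul_le r 0 m n

lemma tendsto_neg_log_persistenceProb_div (r : ℝ) :
    Tendsto (fun n : ℕ => -Real.log (persistenceProb P Z r n) / n) atTop
      (𝓝 (persistenceExponent P Z r)) := by
  have hlim := (h.subadditive_neg_log_persistenceProb r).tendsto_lim
    ⟨0, Set.forall_mem_range.2
      (h.isCenteredGaussianWithCorr.neg_log_persistenceProb_div_nonneg r)⟩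
  rwa [Subadditive.lim] at hlim

lemma exists_persistenceProb_le_exp (hsum : ∑' τ, supCorr (stationaryCorr a) τ ≠ ∞) {r θ : ℝ}
    (hθ : θ < persistenceExponent P Z r) :
    ∃ r' > r, ∀ M : ℕ, persistenceProb P Z r' M ≤ Real.exp (-(θ * M)) := by
  have hG := h.isCenteredGaussianWithCorr
  set E := persistenceExponent P Z r
  set B := (2 * ∑' τ, supCorr (stationaryCorr a) τ).toReal
  obtain ⟨p, q, hpq, η, hη, hθη⟩ := exists_holderConjugate_lt_div_sub hθ B
  refine ⟨r + η, lt_add_of_pos_right r hη, fun M => ?_⟩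
  set S := corrMatrix (stationaryCorr a) (window 0 M)
  have hrow (i : Fin M) : 1 ≤ ∑ j, S i j :=
    (hG.corr_self _).ge.trans (Finset.single_le_sum (f := fun j => S i j)
      (fun j _ => hG.nonneg _ _) (Finset.mem_univ i))
  have hS : ∑ i, ∑ j, S i j ≤ M * B := by
    simpa only [Fintype.card_fin] using hG.sum_corrMatrix_le hsum (window_injective 0 M)
  have hq : 0 ≤ q - 1 := sub_nonneg.2 hpq.symm.lt.le
  calc persistenceProb P Z (r + η) M
      ≤ persistenceProb P Z r M ^ (1 / p) *
          Real.exp ((q - 1) * η ^ 2 * (∑ i, ∑ j, S i j) / 2) := by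
        simp only [hG.persistenceProb_eq_windowProb]
        exact orthantProb_const_add_le (hG.posSemidef_corrMatrix _) hrow hpq r hη.le
    _ ≤ Real.exp (-(E * M)) ^ (1 / p) * Real.exp ((q - 1) * η ^ 2 * (M * B) / 2) := by
        gcongr
        · exact (hG.persistenceProb_pos r M).le
        · exact hpq.one_div_nonneg
        · exact hG.persistenceProb_le_exp r M
    _ = Real.exp (-((E / p - (q - 1) * η ^ 2 * B / 2) * M)) := by
        rw [← Real.exp_mul, ← Real.exp_add]
        ring_nf
    _ ≤ Real.exp (-(θ * M)) := by gcongr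

end IsStationaryCenteredGaussianWithCorr

end PersistenceExponent

section Asymptotics

lemma one_sub_div_sq_le_gaussianReal_Iio (v : NNReal) {η : ℝ} (hη : 0 < η) :
    1 - v / η ^ 2 ≤ (gaussianReal 0 v).real (Set.Iio η) := by
  have hcheb := meas_ge_le_variance_div_sq (memLp_id_gaussianReal (μ := 0) (v := v) 2) hη
  have htail : (gaussianReal 0 v).real (Set.Ici η) ≤ v / η ^ 2 := by
    refine ENNReal.toReal_le_of_le_ofReal (by positivity) ((measure_mono fun x hx => ?_).trans
      (hcheb.trans_eq (by rw [variance_id_gaussianReal])))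
    simpa using le_abs.2 (Or.inl hx)
  have hcompl := probReal_compl_eq_one_sub (μ := gaussianReal 0 v) (measurableSet_Iio (a := η))
  rw [Set.compl_Iio] at hcompl
  linarith

lemma exists_noise_parameters {r r' c : ℝ} (hr : r < r') (hc : c < 1) :
    ∃ η δ v : ℝ, 0 < δ ∧ δ < v ∧ (r + η) / √(1 + v) ≤ r' ∧
      c ≤ √((v - δ) / (v + δ)) * (gaussianReal 0 (v - δ).toNNReal).real (Set.Iio η) := by
  obtain ⟨η, hη, hr'⟩ : ∃ η > 0, r + η < r' := ⟨(r' - r) / 2, by linarith, by linarith⟩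
  -- With `δ = v²` both parameters become negligible as `v → 0`, and so does `δ / v`.
  have hlevel : Tendsto (fun v : ℝ => (r + η) / √(1 + v)) (𝓝[>] 0) (𝓝 ((r + η) / √(1 + 0))) :=
    (ContinuousAt.tendsto (by fun_prop (disch := simp))).mono_left nhdsWithin_le_nhds
  have hcost : Tendsto (fun v : ℝ => √((1 - v) / (1 + v)) * (1 - (v - v ^ 2) / η ^ 2)) (𝓝[>] 0)
      (𝓝 (√((1 - 0) / (1 + 0)) * (1 - (0 - 0 ^ 2) / η ^ 2))) :=
    (ContinuousAt.tendsto (by fun_prop (disch := simp))).mono_left nhdsWithin_le_nhds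
  obtain ⟨v, ⟨⟨hv, hv1⟩, hlv⟩, hcv⟩ := (((Filter.eventually_mem_set.2
    (Ioo_mem_nhdsGT one_pos)).and (hlevel.eventually_lt_const (by simpa using hr'))).and
    (hcost.eventually_const_lt (by simpa using hc))).exists
  have hδv : v ^ 2 < v := by nlinarith
  refine ⟨η, v ^ 2, v, pow_pos hv 2, hδv, hlv.le, hcv.le.trans ?_⟩
  have hratio : (v - v ^ 2) / (v + v ^ 2) = (1 - v) / (1 + v) := by
    field_simp
  rw [hratio]
  refine mul_le_mul_of_nonneg_left ?_ (Real.sqrt_nonneg _)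
  have hgauss := one_sub_div_sq_le_gaussianReal_Iio (v - v ^ 2).toNNReal hη
  rwa [Real.coe_toNNReal _ (sub_nonneg.2 hδv.le)] at hgauss

lemma exists_eventually_mul_le_mul_div {x y : ℝ} (hxy : x < y) (L : ℕ) :
    ∃ M : ℕ, 0 < M ∧ ∀ᶠ n : ℕ in atTop, x * n ≤ y * (n / (M + L) * M : ℕ) := by
  have hgap : Tendsto (fun M : ℕ => y * ((M : ℝ) / (M + L))) atTop (𝓝 (y * 1)) :=
    (tendsto_natCast_div_add_atTop (L : ℝ)).const_mul y
  obtain ⟨M, hM, hM0⟩ := ((hgap.eventually_const_lt (by rwa [mul_one])).and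
    (eventually_gt_atTop 0)).exists
  refine ⟨M, hM0, ?_⟩
  have hblocks : Tendsto (fun n : ℕ => ((n / (M + L) : ℕ) : ℝ) / n) atTop (𝓝 (1 / (M + L))) := by
    have := (tendsto_nat_floor_mul_div_atTop (a := 1 / ((M : ℝ) + L)) (by positivity)).comp
      tendsto_natCast_atTop_atTop
    refine this.congr fun n => ?_
    rw [Function.comp_apply, ← Nat.floor_div_eq_div (K := ℝ), Nat.cast_add, one_div_mul_eq_div]
  have hlim : Tendsto (fun n : ℕ => y * ((n / (M + L) : ℕ) / n * M)) atTop
      (𝓝 (y * (1 / (M + L) * M))) := (hblocks.mul_const _).const_mul y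
  filter_upwards [hlim.eventually_const_lt (by rwa [one_div_mul_eq_div]),
    eventually_gt_atTop 0] with n hn hn0
  have : (0 : ℝ) < n := by exact_mod_cast hn0
  calc x * n ≤ y * ((n / (M + L) : ℕ) / n * M) * n := by gcongr
    _ = y * (n / (M + L) * M : ℕ) := by
      push_cast
      field_simp

variable {κ : Type*} {l : Filter κ} {Ω : κ → Type*} [∀ k, MeasurableSpace (Ω k)]
  {P : ∀ k, Measure (Ω k)} {Z : ∀ k, ℕ+ → Ω k → ℝ} {A : κ → ℕ+ → ℕ+ → ℝ} {Ω' : Type*}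
  [MeasurableSpace Ω'] {P' : Measure Ω'} {Z' : ℕ+ → Ω' → ℝ} {a : ℕ → ℝ}

lemma eventually_exp_le_persistenceProb (hZ : ∀ k, IsCenteredGaussianWithCorr (P k) (Z k) (A k))
    (hZ' : IsStationaryCenteredGaussianWithCorr P' Z' a)
    (hconv : ∀ τ, TendstoUniformly (fun k s => A k s (shift s τ)) (fun _ => a τ) l) {r θ : ℝ}
    (hθ : persistenceExponent P' Z' r < θ) :
    ∀ᶠ p : κ × ℕ in l ×ˢ atTop,
      Real.exp (-(θ * p.2)) ≤ persistenceProb (P p.1) (Z p.1) r p.2 := by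
  have hG := hZ'.isCenteredGaussianWithCorr
  obtain ⟨θ', hθ', hθ'θ⟩ := exists_between hθ
  have hθ'0 : 0 ≤ θ' := (hG.persistenceExponent_nonneg r).trans hθ'.le
  obtain ⟨M, hM, hlt⟩ := hG.exists_exp_lt_persistenceProb hθ'
  set c := Real.exp (-(θ' * M))
  have hblock : ∀ᶠ k in l, ∀ s, c ≤ windowProb (A k) r s M := by
    rw [hG.persistenceProb_eq_windowProb] at hlt
    exact mem_prod_top.1 ((tendsto_windowProb hZ hG hconv r M).eventually_const_le hlt)
  have hlarge : ∀ᶠ n : ℕ in atTop, θ' * M / (θ - θ') ≤ n :=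
    tendsto_natCast_atTop_atTop.eventually_ge_atTop _
  filter_upwards [hblock.prod_mk hlarge] with ⟨k, n⟩ ⟨hk, hn⟩
  have hnM : (n / M + 1 : ℕ) * (M : ℝ) ≤ n + M := by
    exact_mod_cast (Nat.succ_mul _ _).trans_le (Nat.add_le_add_right (Nat.div_mul_le_self n M) M)
  calc Real.exp (-(θ * n)) ≤ Real.exp (-(θ' * ((n / M + 1 : ℕ) * M))) := by
        rw [div_le_iff₀ (sub_pos.2 hθ'θ)] at hn
        refine Real.exp_le_exp.2 (neg_le_neg ?_)
        nlinarith
    _ = c ^ (n / M + 1) := by rw [← Real.exp_nat_mul]; ring_nf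
    _ ≤ persistenceProb (P k) (Z k) r ((n / M + 1) * M) := by
        rw [(hZ k).persistenceProb_eq_windowProb]
        exact (hZ k).pow_le_windowProb (Real.exp_nonneg _) hk 0 _
    _ ≤ persistenceProb (P k) (Z k) r n :=
        (hZ k).persistenceProb_antitone r (Nat.lt_mul_of_div_lt (Nat.lt_succ_self _) hM).le

lemma exists_eventually_two_mul_tsum_supCorr_le
    (htail : Tendsto (fun L : ℕ => limsup (fun k => ∑' i : ℕ, supCorr (A k) (L + i)) l) atTop
      (𝓝 0)) {x : ℝ} (hx : 0 < x) :
    ∃ L : ℕ, ∀ᶠ k in l, 2 * ∑' i, supCorr (A k) (L + i) ≤ ENNReal.ofReal x := by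
  obtain ⟨L, hL⟩ := (htail.eventually_lt_const (ENNReal.ofReal_pos.2 (half_pos hx))).exists
  refine ⟨L, (eventually_lt_of_limsup_lt hL).mono fun k hk => ?_⟩
  calc 2 * ∑' i, supCorr (A k) (L + i) ≤ 2 * ENNReal.ofReal (x / 2) := by gcongr
    _ = ENNReal.ofReal x := by
      rw [← ENNReal.ofReal_ofNat, ← ENNReal.ofReal_mul zero_le_two, mul_div_cancel₀ _ two_ne_zero]

lemma tsum_supCorr_stationaryCorr_ne_top [l.NeBot]
    (hconv : ∀ τ, TendstoUniformly (fun k s => A k s (shift s τ)) (fun _ => a τ) l)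
    (htail : Tendsto (fun L : ℕ => limsup (fun k => ∑' i : ℕ, supCorr (A k) (L + i)) l) atTop
      (𝓝 0)) :
    ∑' i, supCorr (stationaryCorr a) i ≠ ∞ := by
  obtain ⟨L, hL⟩ := (htail.eventually_lt_const one_pos).exists
  have hle := tsum_supCorr_stationaryCorr_le hconv
    ((eventually_lt_of_limsup_lt hL).mono fun k hk => hk.le)
  rw [← ENNReal.summable.sum_add_tsum_nat_add' (k := L)]
  simp only [add_comm _ L]
  refine ENNReal.add_ne_top.2 ⟨ENNReal.sum_ne_top.2 fun i _ => ?_,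
    ne_top_of_le_ne_top ENNReal.one_ne_top hle⟩
  rw [supCorr_stationaryCorr]
  exact ENNReal.ofReal_ne_top

lemma eventually_persistenceProb_le_exp [l.NeBot]
    (hZ : ∀ k, IsCenteredGaussianWithCorr (P k) (Z k) (A k))
    (hZ' : IsStationaryCenteredGaussianWithCorr P' Z' a)
    (hconv : ∀ τ, TendstoUniformly (fun k s => A k s (shift s τ)) (fun _ => a τ) l)
    (htail : Tendsto (fun L : ℕ => limsup (fun k => ∑' i : ℕ, supCorr (A k) (L + i)) l) atTop
      (𝓝 0)) {r θ : ℝ} (hθ : θ < persistenceExponent P' Z' r) :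
    ∀ᶠ p : κ × ℕ in l ×ˢ atTop,
      persistenceProb (P p.1) (Z p.1) r p.2 ≤ Real.exp (-(θ * p.2)) := by
  have hG := hZ'.isCenteredGaussianWithCorr
  obtain ⟨θ₁, hθ₁, hθ₁'⟩ := exists_between hθ
  obtain ⟨θ₂, hθ₂, hθ₂'⟩ := exists_between hθ₁'
  obtain ⟨θ₃, hθ₃, hθ₃'⟩ := exists_between hθ₂'
  obtain ⟨r', hr', hle⟩ := hZ'.exists_persistenceProb_le_exp
    (tsum_supCorr_stationaryCorr_ne_top hconv htail) hθ₃'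
  obtain ⟨η, δ, v, hδ, hδv, hlevel, hcost⟩ := exists_noise_parameters hr'
    (Real.exp_lt_one_iff.2 (sub_neg.2 hθ₂))
  obtain ⟨L, hL⟩ := exists_eventually_two_mul_tsum_supCorr_le htail hδ
  obtain ⟨M, hM, hn⟩ := exists_eventually_mul_le_mul_div hθ₁ L
  have hblock : ∀ᶠ k in l, ∀ s,
      windowProb (A k) ((r + η) / √(1 + v)) s M ≤ Real.exp (-(θ₂ * M)) := by
    have hlt : windowProb (stationaryCorr a) ((r + η) / √(1 + v)) 0 M < Real.exp (-(θ₂ * M)) := by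
      rw [← hG.persistenceProb_eq_windowProb]
      refine ((hG.persistenceProb_mono_threshold M hlevel).trans (hle M)).trans_lt ?_
      gcongr
    exact mem_prod_top.1 ((tendsto_windowProb hZ hG hconv _ M).eventually_le_const hlt)
  filter_upwards [(hblock.and hL).prod_mk hn] with ⟨k, n⟩ ⟨⟨hk, hLk⟩, hn⟩
  set q := n / (M + L)
  have hdecouple : persistenceProb (P k) (Z k) r n * Real.exp (θ₁ - θ₂) ^ (q * M) ≤
      Real.exp (-(θ₂ * M)) ^ q :=
    (mul_le_mul_of_nonneg_left (pow_le_pow_left₀ (Real.exp_nonneg _) hcost _)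
      ((hZ k).persistenceProb_pos r n).le).trans
      ((hZ k).persistenceProb_mul_pow_le (Nat.div_mul_le_self n (M + L)) (hδ.trans hδv).le hδv
        ((hZ k).sum_corrMatrix_spacedWindows_le hδ.le hLk q M) r η hk)
  calc persistenceProb (P k) (Z k) r n
      ≤ Real.exp (-(θ₂ * M)) ^ q / Real.exp (θ₁ - θ₂) ^ (q * M) :=
        (le_div_iff₀ (by positivity)).2 hdecouple
    _ = Real.exp (-(θ₁ * (q * M : ℕ))) := by
        rw [← Real.exp_nat_mul, ← Real.exp_nat_mul, ← Real.exp_sub]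
        push_cast
        ring_nf
    _ ≤ Real.exp (-(θ * n)) := by gcongr

lemma tendsto_neg_log_persistenceProb_div [l.NeBot]
    (hZ : ∀ k, IsCenteredGaussianWithCorr (P k) (Z k) (A k))
    (hZ' : IsStationaryCenteredGaussianWithCorr P' Z' a)
    (hconv : ∀ τ, TendstoUniformly (fun k s => A k s (shift s τ)) (fun _ => a τ) l)
    (htail : Tendsto (fun L : ℕ => limsup (fun k => ∑' i : ℕ, supCorr (A k) (L + i)) l) atTop
      (𝓝 0)) (r : ℝ) :
    Tendsto (fun p : κ × ℕ => -Real.log (persistenceProb (P p.1) (Z p.1) r p.2) / p.2)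
      (l ×ˢ atTop) (𝓝 (persistenceExponent P' Z' r)) := by
  have hpos : ∀ᶠ p : κ × ℕ in l ×ˢ atTop, (0 : ℝ) < p.2 :=
    (tendsto_natCast_atTop_atTop.comp tendsto_snd).eventually_gt_atTop 0
  refine tendsto_order.2 ⟨fun θ hθ => ?_, fun θ hθ => ?_⟩ <;>
    obtain ⟨θ', hθ', hθ''⟩ := exists_between hθ
  · filter_upwards [eventually_persistenceProb_le_exp hZ hZ' hconv htail hθ'', hpos] with p hp hn
    refine hθ'.trans_le ((le_div_iff₀ hn).2 (le_neg.1 ?_))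
    exact (Real.log_le_iff_le_exp ((hZ p.1).persistenceProb_pos r p.2)).2 hp
  · filter_upwards [eventually_exp_le_persistenceProb hZ hZ' hconv hθ', hpos] with p hp hn
    refine ((div_le_iff₀ hn).2 (neg_le.1 ?_)).trans_lt hθ''
    exact (Real.le_log_iff_exp_le ((hZ p.1).persistenceProb_pos r p.2)).2 hp

end Asymptotics

end Persistence

theorem lemma3p4_general {κ : Type*} {l : Filter κ}
    {Ω : κ → Type*} [∀ k, MeasurableSpace (Ω k)] (P : ∀ k, Measure (Ω k))
    (Z : ∀ k, ℕ+ → Ω k → ℝ) (A : κ → ℕ+ → ℕ+ → ℝ)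
    {Ωinf : Type*} [MeasurableSpace Ωinf] (Pinf : Measure Ωinf)
    (Zinf : ℕ+ → Ωinf → ℝ) (Ainf : ℕ → ℝ)
    (hZ : ∀ k, Persistence.IsCenteredGaussianWithCorr (P k) (Z k) (A k))
    (hZinf : Persistence.IsStationaryCenteredGaussianWithCorr Pinf Zinf Ainf)
    (hconv : ∀ τ : ℕ, TendstoUniformly
      (fun (k : κ) (s : ℕ+) => A k s (Persistence.shift s τ)) (fun _ => Ainf τ) l)
    (htail : Tendsto
      (fun L : ℕ => limsup (fun k : κ => ∑' i : ℕ, Persistence.supCorr (A k) (L + i)) l)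
      atTop (𝓝 0))
    (r : ℝ) :
    (∀ k n, 0 < Persistence.persistenceProb (P k) (Z k) r n) ∧
    (∀ n, 0 < Persistence.persistenceProb Pinf Zinf r n) ∧
    Tendsto
      (fun p : κ × ℕ => 1 / (p.2 : ℝ) *
        |Real.log (Persistence.persistenceProb (P p.1) (Z p.1) r p.2) -
          Real.log (Persistence.persistenceProb Pinf Zinf r p.2)|)
      (l ×ˢ atTop) (𝓝 0) := by
  refine ⟨fun k => (hZ k).persistenceProb_pos r,
    hZinf.isCenteredGaussianWithCorr.persistenceProb_pos r, ?_⟩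
  rcases l.eq_or_neBot with rfl | _
  · rw [bot_prod]
    exact tendsto_bot
  have hdiff := (Persistence.tendsto_neg_log_persistenceProb_div hZ hZinf hconv htail r).sub
    ((hZinf.tendsto_neg_log_persistenceProb_div r).comp tendsto_snd)
  rw [sub_self, tendsto_zero_iff_abs_tendsto_zero] at hdiff
  refine hdiff.congr fun p => ?_
  rw [Function.comp_apply, Function.comp_apply, ← sub_div, abs_div, Nat.abs_cast, neg_sub_neg,
    abs_sub_comm, div_eq_inv_mul, one_div]

theorem lemma3p4
    {Ω : ℕ+ → Type*} [∀ k, MeasurableSpace (Ω k)] (P : ∀ k, Measure (Ω k))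
    (Z : ∀ k, ℕ+ → Ω k → ℝ) (A : ℕ+ → ℕ+ → ℕ+ → ℝ)
    {Ωinf : Type*} [MeasurableSpace Ωinf] (Pinf : Measure Ωinf)
    (Zinf : ℕ+ → Ωinf → ℝ) (Ainf : ℕ → ℝ)
    (hZ : ∀ k, Persistence.IsCenteredGaussianWithCorr (P k) (Z k) (A k))
    (hZinf : Persistence.IsStationaryCenteredGaussianWithCorr Pinf Zinf Ainf)
    (hconv : ∀ τ : ℕ, TendstoUniformly
      (fun (k : ℕ+) (s : ℕ+) => A k s (Persistence.shift s τ)) (fun _ => Ainf τ) atTop)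
    (htail : Tendsto
      (fun L : ℕ => limsup (fun k : ℕ+ => ∑' i : ℕ, Persistence.supCorr (A k) (L + i)) atTop)
      atTop (𝓝 0))
    (r : ℝ) :
    (∀ k n, 0 < Persistence.persistenceProb (P k) (Z k) r n) ∧
    (∀ n, 0 < Persistence.persistenceProb Pinf Zinf r n) ∧
    Tendsto
      (fun p : ℕ+ × ℕ => 1 / (p.2 : ℝ) *
        |Real.log (Persistence.persistenceProb (P p.1) (Z p.1) r p.2) -
          Real.log (Persistence.persistenceProb Pinf Zinf r p.2)|)
      (atTop ×ˢ atTop) (𝓝 0) :=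
  lemma3p4_general P Z A Pinf Zinf Ainf hZ hZinf hconv htail r
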